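/- Let $G$ be a (discrete) group, and write $H_n(G)=H_n(G;\mathbb Z)$ for its integral group homology. A central extension of $G$ is a short exact sequence of groups $A\to\widetilde G\to G$ with $A$ an arbitrary abelian group whose image in $\widetilde G$ is central; a map of central extensions is a pair of homomorphisms $A\to A'$, $\widetilde G\to\widetilde G'$ that commute with the structure maps and induce the identity of $G$. These form the category $Ext(G)$, and a Schur cover of $G$ is an initial object of $Ext(G)$. A categorical group is a small monoidal groupoid in which every object is weakly invertible. A central categorical extension $1/\!\!/A\to\mathcal G\to G$ is a categorical group $\mathcal G$ with identifications $A\cong \mathrm{aut}_{\mathcal G}(1)$ and $\pi_0\mathcal G\cong G$, where $A$ is an arbitrary abelian group, such that the conjugation action of $G$ on $A$ is trivial. With strong monoidal functors over $G$ (together with the induced homomorphisms on centers) as 1-morphisms and monoidal natural transformations as 2-morphisms these form a bicategory $\mathcal E\!xt(G)$. A categorical Schur cover of $G$ is an initial object $\mathcal G_{uni}$ of $\mathcal E\!xt(G)$: for every object $\mathcal G$ there is a 1-morphism $\mathcal G_{uni}\to\mathcal G$, and between any two such 1-morphisms there is exactly one 2-isomorphism. For a homomorphism $\phi:A\to B$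 of abelian groups, $\mathcal G[\phi]$ is the central categorical extension with center $B$ that has the objects of $\mathcal G$, has as arrows the classes of pairs $(f,b)$, with $f$ an arrow of $\mathcal G$ and $b\in B$, modulo $(f\bullet a,b)\sim(f,\phi(a)+b)$ for $a\in A$, and inherits its remaining structure from $\mathcal G$. For an abelian group $H$ let $H\!\downarrow\!\mathcal Ab$ be the category of abelian groups under $H$. **Theorem.** 1. Let $G$ be perfect. Then $G$ has a Schur cover. For every Schur cover $A_{uni}\to\widetilde G_{uni}\to G$ one has $A_{uni}\cong H_2(G)$, and for every choice of such an isomorphism the functor $$\widetilde G_{uni}[-]:H_2(G)\!\downarrow\!\mathcal Ab\longrightarrow Ext(G),\qquad (\phi:H_2(G)\to A)\longmapsto A\times_{H_2(G)}\widetilde G_{uni},$$ is an equivalence of categories. 2. Let $G$ be superperfect, that is, perfect with $H_2(G)=0$. Then $G$ has a categorical Schur cover. For every categorical Schur cover $1/\!\!/A_{uni}\to\mathcal G_{uni}\to G$ one has $A_{uni}\cong H_3(G)$, and for every choice of such an isomorphism the pseudofunctor $$\mathcal G_{uni}[-]:H_3(G)\!\downarrow\!\mathcal Ab\longrightarrow\mathcal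 E\!xt(G),\qquad \phi\longmapsto\mathcal G_{uni}[\phi],$$ is an equivalence of bicategories, where $H_3(G)\!\downarrow\!\mathcal Ab$ is regarded as a bicategory with only identity 2-morphisms. (That is, it is essentially surjective on objects up to equivalence, and an equivalence on all categories of 1-morphisms.) -/

import Mathlib

open CategoryTheory MonoidalCategory

universe u

/-! ### Group homology and (super)perfect groups -/

/-- The integral homology group `Hₙ(G) = Hₙ(G, ℤ)` of the discrete group `G`, with `ℤ` the trivial
`G`-module, written multiplicatively. (`ULift` only moves `ℤ` to the universe of `G`.) -/
noncomputable def integralHomology (G : Type u) [Group G] (n : ℕ) : CommGrpCat.{u} :=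
  CommGrpCat.of
    (Multiplicative (groupHomology (Rep.trivial (ULift.{u} ℤ) G (ULift.{u} ℤ)) n))

/-- A group is superperfect if it is perfect and its Schur multiplier `H₂(G)` vanishes. -/
def IsSuperperfect (G : Type u) [Group G] : Prop :=
  Group.IsPerfect G ∧ Subsingleton (integralHomology G 2)

/-! ### Central extensions -/

/-- A central extension `A → E → G` of the group `G`, with `A` an arbitrary abelian group. -/
structure CentralExtension (G : Type u) [Group G] where
  /-- the central subgroup -/
  A : CommGrpCat.{u}
  /-- the total group -/
  E : Type u
  [group : Group E]
  /-- the short exact sequence `A → E → G` -/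
  ext : GroupExtension A E G
  central : ∀ (a : A) (e : E), ext.inl a * e = e * ext.inl a

namespace CentralExtension

attribute [instance] CentralExtension.group

variable {G : Type u} [Group G]

/-- A map of central extensions of `G`: a commutative diagram that is the identity on `G`. -/
@[ext]
structure Hom (S T : CentralExtension G) where
  /-- the map of central subgroups -/
  φ : S.A ⟶ T.A
  /-- the map of total groups -/
  f : S.E →* T.E
  f_inl : ∀ a : S.A, f (S.ext.inl a) = T.ext.inl (φ a)
  rightHom_f : ∀ e : S.E, T.ext.rightHom (f e) = S.ext.rightHom e

/-- The category `Ext(G)` of central extensions of `G`. -/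
instance : Category (CentralExtension G) where
  Hom := Hom
  id S := { φ := 𝟙 _, f := MonoidHom.id _, f_inl := fun _ => rfl, rightHom_f := fun _ => rfl }
  comp h k :=
    { φ := h.φ ≫ k.φ
      f := k.f.comp h.f
      f_inl := fun a => by simp [h.f_inl, k.f_inl]
      rightHom_f := fun e => by simp [h.rightHom_f, k.rightHom_f] }

/-- A Schur cover of `G` is a universal central extension: an initial object of `Ext(G)`. -/
def IsSchurCover (S : CentralExtension G) : Prop := Nonempty (Limits.IsInitial S)

variable (S : CentralExtension G) {B : CommGrpCat.{u}} (φ : S.A ⟶ B)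

/-- The subgroup of `B × E` of all `(φ z, z⁻¹)`, `z ∈ A`. -/
def balancedSubgroup : Subgroup (B × S.E) :=
  (φ.hom.prod (S.ext.inl.comp invMonoidHom)).range

instance : (S.balancedSubgroup φ).Normal where
  conj_mem := by
    rintro _ ⟨z, rfl⟩ ⟨b, e⟩
    refine ⟨z, Prod.ext ?_ ?_⟩
    · simp
    · simp only [MonoidHom.prod_apply, MonoidHom.comp_apply, Prod.mk_mul_mk, Prod.inv_mk]
      rw [← S.central]
      simp

/-- The balanced product `B ×_A E`: the quotient of `B × E` by `(b φ(z), e) ∼ (b, z e)`. -/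
abbrev BalancedProduct : Type u := (B × S.E) ⧸ S.balancedSubgroup φ

/-- The central extension `B → B ×_A E → G`. -/
def balancedExtension : CentralExtension G where
  A := B
  E := S.BalancedProduct φ
  ext :=
    { inl := (QuotientGroup.mk' (S.balancedSubgroup φ)).comp (MonoidHom.inl B S.E)
      rightHom := QuotientGroup.lift (S.balancedSubgroup φ)
        (S.ext.rightHom.comp (MonoidHom.snd B S.E)) (by
          rintro _ ⟨z, rfl⟩
          simp)
      inl_injective := by
        rw [injective_iff_map_eq_one]
        intro b hb
        obtain ⟨z, hz⟩ := (QuotientGroup.eq_one_iff _).1 hb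
        obtain ⟨h1, h2⟩ := Prod.ext_iff.1 hz
        have : z = 1 := by
          have h3 : S.ext.inl z⁻¹ = 1 := h2
          rw [map_eq_one_iff _ S.ext.inl_injective] at h3
          simpa using h3
        subst this
        simpa using h1.symm
      range_inl_eq_ker_rightHom := by
        ext x
        constructor
        · rintro ⟨b, rfl⟩
          exact map_one S.ext.rightHom
        · induction x using QuotientGroup.induction_on with
          | H x =>
            obtain ⟨b, e⟩ := x
            intro h
            have he : e ∈ S.ext.rightHom.ker := h
            rw [← S.ext.range_inl_eq_ker_rightHom] at he
            obtain ⟨z, rfl⟩ := he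
            refine ⟨b * φ z, ?_⟩
            refine QuotientGroup.eq.2 ⟨z⁻¹, Prod.ext ?_ ?_⟩
            · simp [mul_comm]
            · simp
      rightHom_surjective := fun g => by
        obtain ⟨e, rfl⟩ := S.ext.rightHom_surjective g
        exact ⟨QuotientGroup.mk (1, e), rfl⟩ }
  central := fun b x => by
    induction x using QuotientGroup.induction_on with
    | H x =>
      change (QuotientGroup.mk ((b, 1) * x) : S.BalancedProduct φ) = QuotientGroup.mk (x * (b, 1))
      congr 1
      exact Prod.ext (mul_comm _ _) (by simp)

/-- The map `B ×_A E → C ×_A E`, `[b, e] ↦ [ψ b, e]`, induced by `ψ : B → C` under `A`. -/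
def balancedMap {C : CommGrpCat.{u}} {φ : S.A ⟶ B} {φ' : S.A ⟶ C} (ψ : B ⟶ C)
    (w : φ ≫ ψ = φ') : S.balancedExtension φ ⟶ S.balancedExtension φ' where
  φ := ψ
  f := QuotientGroup.map (S.balancedSubgroup φ) (S.balancedSubgroup φ')
    (ψ.hom.prodMap (MonoidHom.id S.E)) (by
      subst w
      rintro _ ⟨z, rfl⟩
      exact ⟨z, rfl⟩)
  f_inl _ := rfl
  rightHom_f e := by
    induction e using QuotientGroup.induction_on with
    | H x => rfl

/-- For `i : A → H` the functor `S[-] : H ↓ Ab ⥤ Ext(G)` sending `φ : H → B` to the balanced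
product of `B` and `S` along `A → H → B`. -/
def pushout {H : CommGrpCat.{u}} (i : S.A ⟶ H) : Under H ⥤ CentralExtension G where
  obj X := S.balancedExtension (B := X.right) (i ≫ X.hom)
  map {X Y} f := S.balancedMap (B := X.right) (C := Y.right) f.right (by
    rw [Category.assoc, Under.w])
  map_id X := by
    refine Hom.ext (by simp [balancedMap]; rfl) (MonoidHom.ext fun x => ?_)
    induction x using QuotientGroup.induction_on with
    | H x => rfl
  map_comp f g := by
    refine Hom.ext (by simp [balancedMap]; rfl) (MonoidHom.ext fun x => ?_)
    induction x using QuotientGroup.induction_on with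
    | H x => rfl

end CentralExtension

/-! ### Categorical groups and their central extensions -/

/-- A (small) monoidal category is a categorical group if it is a groupoid and every object is
weakly invertible. -/
structure IsCategoricalGroup (C : Type u) [Category.{u} C] [MonoidalCategory C] : Prop where
  isGroupoid : IsGroupoid C
  exists_weakInverse : ∀ X : C, ∃ Y : C, Nonempty (X ⊗ Y ≅ 𝟙_ C) ∧ Nonempty (Y ⊗ X ≅ 𝟙_ C)

/-- A central categorical extension `1//A → 𝒢 → G` of the discrete group `G`, with `A` an arbitrary
abelian group: a categorical group `𝒢` with identifications `A ≅ aut(𝟙)` (in a groupoid, all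
endomorphisms are automorphisms) and `π₀ 𝒢 ≅ G`, such that the conjugation action of `G` on `A` is
trivial. -/
structure CategoricalCentralExtension (G : Type u) [Group G] where
  /-- the center -/
  A : CommGrpCat.{u}
  /-- the objects of `𝒢` -/
  Obj : Type u
  [category : Category.{u} Obj]
  [monoidal : MonoidalCategory Obj]
  isCategoricalGroup : IsCategoricalGroup Obj
  /-- the identification of `A` with the automorphism group of the unit object -/
  ι : A ≃* End (𝟙_ Obj)
  /-- the monoidal functor from `𝒢` to the discrete monoidal category `G`, on objects -/
  p : Obj → G
  p_tensor : ∀ X Y : Obj, p (X ⊗ Y) = p X * p Y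
  p_surjective : Function.Surjective p
  p_eq_iff : ∀ X Y : Obj, p X = p Y ↔ Nonempty (X ≅ Y)
  /-- tensoring an object with `a` on the left is the same as tensoring it with `a` on the right -/
  central : ∀ (a : A) (X : Obj),
    (λ_ X).inv ≫ (show 𝟙_ Obj ⟶ 𝟙_ Obj from ι a) ▷ X ≫ (λ_ X).hom =
      (ρ_ X).inv ≫ X ◁ (show 𝟙_ Obj ⟶ 𝟙_ Obj from ι a) ≫ (ρ_ X).hom

namespace CategoricalCentralExtension

attribute [instance] CategoricalCentralExtension.category CategoricalCentralExtension.monoidal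

variable {G : Type u} [Group G]

section Bicategory

/-- A 1-morphism of central categorical extensions of `G`: a (strong) monoidal functor over `G`,
together with the homomorphism that it induces on centers. -/
structure Hom (S T : CategoricalCentralExtension G) where
  /-- the homomorphism on centers -/
  φ : S.A ⟶ T.A
  /-- the monoidal functor -/
  F : S.Obj ⥤ T.Obj
  [monoidal : F.Monoidal]
  F_ι : ∀ a : S.A, Functor.LaxMonoidal.ε F ≫ F.map (S.ι a) =
    (show 𝟙_ T.Obj ⟶ 𝟙_ T.Obj from T.ι (φ a)) ≫ Functor.LaxMonoidal.ε F
  p_F : ∀ X : S.Obj, T.p (F.obj X) = S.p X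

attribute [instance] Hom.monoidal

/-- A 2-morphism: a monoidal natural transformation. -/
@[ext]
structure Hom₂ {S T : CategoricalCentralExtension G} (f g : Hom S T) where
  /-- the natural transformation -/
  τ : f.F ⟶ g.F
  [isMonoidal : NatTrans.IsMonoidal τ]

attribute [instance] Hom₂.isMonoidal

instance (S T : CategoricalCentralExtension G) : Category (Hom S T) where
  Hom := Hom₂
  id f := { τ := 𝟙 f.F }
  comp s t := { τ := s.τ ≫ t.τ }

@[ext]
lemma hom₂_ext {S T : CategoricalCentralExtension G} {f g : Hom S T} {s t : f ⟶ g}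
    (h : ∀ X, s.τ.app X = t.τ.app X) : s = t :=
  Hom₂.ext (NatTrans.ext (funext h))

@[simp]
lemma id_τ {S T : CategoricalCentralExtension G} (f : Hom S T) : Hom₂.τ (𝟙 f) = 𝟙 f.F := rfl

@[simp]
lemma comp_τ {S T : CategoricalCentralExtension G} {f g h : Hom S T} (s : f ⟶ g) (t : g ⟶ h) :
    (s ≫ t).τ = s.τ ≫ t.τ := rfl

/-- An isomorphism of underlying functors that is monoidal gives an invertible 2-morphism. -/
def isoMk {S T : CategoricalCentralExtension G} {f g : Hom S T} (e : f.F ≅ g.F)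
    [NatTrans.IsMonoidal e.hom] : f ≅ g where
  hom := { τ := e.hom }
  inv := { τ := e.inv }
  hom_inv_id := Hom₂.ext e.hom_inv_id
  inv_hom_id := Hom₂.ext e.inv_hom_id

instance : CategoryStruct (CategoricalCentralExtension G) where
  Hom := Hom
  id S :=
    { φ := 𝟙 _
      F := 𝟭 _
      F_ι := fun a => by
        change 𝟙 _ ≫ _ = _ ≫ 𝟙 _
        rw [Category.id_comp, Category.comp_id]
        rfl
      p_F := fun _ => rfl }
  comp f g :=
    { φ := f.φ ≫ g.φ
      F := f.F ⋙ g.F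
      F_ι := fun a => by
        simp only [Functor.LaxMonoidal.comp_ε, Functor.comp_map, Category.assoc]
        rw [← Functor.map_comp, f.F_ι, Functor.map_comp, ← Category.assoc, g.F_ι, Category.assoc]
        rfl
      p_F := fun X => by
        rw [Functor.comp_obj, g.p_F, f.p_F] }

/-- The bicategory `ℰxt(G)` of central categorical extensions of `G`. -/
instance : Bicategory (CategoricalCentralExtension G) where
  homCategory S T := inferInstanceAs (Category (Hom S T))
  whiskerLeft f _ _ t := { τ := Functor.whiskerLeft f.F t.τ }
  whiskerRight t f := { τ := Functor.whiskerRight t.τ f.F }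
  associator f g h := isoMk (Functor.associator f.F g.F h.F)
  leftUnitor f := isoMk f.F.leftUnitor
  rightUnitor f := isoMk f.F.rightUnitor
  whiskerLeft_id f g := by apply hom₂_ext; intro X; rfl
  whiskerLeft_comp f _ _ _ s t := by apply hom₂_ext; intro X; rfl
  id_whiskerLeft t := by
    apply hom₂_ext; intro X; exact ((Category.id_comp _).trans (Category.comp_id _)).symm
  comp_whiskerLeft f g _ _ t := by
    apply hom₂_ext; intro X; exact ((Category.id_comp _).trans (Category.comp_id _)).symm
  id_whiskerRight f g := by apply hom₂_ext; intro X; exact g.F.map_id _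
  comp_whiskerRight s t f := by apply hom₂_ext; intro X; exact f.F.map_comp _ _
  whiskerRight_id t := by
    apply hom₂_ext; intro X; exact ((Category.id_comp _).trans (Category.comp_id _)).symm
  whiskerRight_comp t f g := by
    apply hom₂_ext; intro X; exact ((Category.id_comp _).trans (Category.comp_id _)).symm
  whisker_assoc f _ _ t g := by
    apply hom₂_ext; intro X; exact ((Category.id_comp _).trans (Category.comp_id _)).symm
  whisker_exchange s t := by apply hom₂_ext; intro X; exact (t.τ.naturality _).symm
  pentagon f g h i := by
    apply hom₂_ext; intro X
    change i.F.map (𝟙 _) ≫ 𝟙 _ ≫ 𝟙 _ = 𝟙 _ ≫ 𝟙 _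
    simp
  triangle f g := by
    apply hom₂_ext; intro X
    change 𝟙 _ ≫ 𝟙 _ = g.F.map (𝟙 _)
    simp

end Bicategory

section Pushout

variable (S : CategoricalCentralExtension G)

/-- An element of the center as an arrow from the unit object to itself. -/
def unitEnd (a : S.A) : 𝟙_ S.Obj ⟶ 𝟙_ S.Obj := S.ι a

lemma unitEnd_one : S.unitEnd 1 = 𝟙 _ := map_one S.ι

lemma unitEnd_mul (a b : S.A) : S.unitEnd (a * b) = S.unitEnd a ≫ S.unitEnd b := by
  rw [mul_comm]
  exact map_mul S.ι b a

/-- The action `f • a` of the center on arrows: tensoring an arrow with `a`. -/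
def act {X Y : S.Obj} (f : X ⟶ Y) (a : S.A) : X ⟶ Y :=
  (ρ_ X).inv ≫ (f ⊗ₘ S.unitEnd a) ≫ (ρ_ Y).hom

/-- The automorphism of `X` given by an element of the center. -/
def objAct (X : S.Obj) (a : S.A) : X ⟶ X := (ρ_ X).inv ≫ X ◁ S.unitEnd a ≫ (ρ_ X).hom

lemma objAct_eq (X : S.Obj) (a : S.A) :
    S.objAct X a = (λ_ X).inv ≫ S.unitEnd a ▷ X ≫ (λ_ X).hom := (S.central a X).symm

lemma act_eq {X Y : S.Obj} (f : X ⟶ Y) (a : S.A) : S.act f a = f ≫ S.objAct Y a := by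
  simp [act, objAct, MonoidalCategory.tensorHom_def]

lemma objAct_comp {X Y : S.Obj} (f : X ⟶ Y) (a : S.A) :
    S.objAct X a ≫ f = f ≫ S.objAct Y a := by
  simp only [objAct, Category.assoc, ← rightUnitor_naturality, rightUnitor_inv_naturality_assoc]
  rw [whisker_exchange_assoc]

lemma objAct_one (X : S.Obj) : S.objAct X 1 = 𝟙 X := by simp [objAct, unitEnd_one]

lemma objAct_mul (X : S.Obj) (a b : S.A) : S.objAct X (a * b) = S.objAct X a ≫ S.objAct X b := by
  simp [objAct, unitEnd_mul]

lemma objAct_unit (a : S.A) : S.objAct (𝟙_ S.Obj) a = S.unitEnd a := by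
  rw [objAct, ← unitors_equal, leftUnitor_naturality, ← unitors_inv_equal, Iso.inv_hom_id_assoc]

lemma whiskerLeft_objAct (X Y : S.Obj) (a : S.A) : X ◁ S.objAct Y a = S.objAct (X ⊗ Y) a := by
  simp [objAct]

lemma objAct_whiskerRight (X Y : S.Obj) (a : S.A) : S.objAct X a ▷ Y = S.objAct (X ⊗ Y) a := by
  rw [← whiskerLeft_objAct, objAct_eq S Y, objAct]
  simp

lemma act_comp {X Y Z : S.Obj} (f : X ⟶ Y) (g : Y ⟶ Z) (a b : S.A) :
    S.act f a ≫ S.act g b = S.act (f ≫ g) (a * b) := by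
  simp only [act_eq, objAct_mul, Category.assoc]
  rw [← Category.assoc (S.objAct Y a), objAct_comp, Category.assoc]

lemma act_one {X Y : S.Obj} (f : X ⟶ Y) : S.act f 1 = f := by simp [act_eq, objAct_one]

lemma act_mul {X Y : S.Obj} (f : X ⟶ Y) (a b : S.A) : S.act f (a * b) = S.act (S.act f a) b := by
  simp [act_eq, objAct_mul]

lemma whiskerLeft_act (X : S.Obj) {Y Z : S.Obj} (f : Y ⟶ Z) (a : S.A) :
    X ◁ S.act f a = S.act (X ◁ f) a := by
  simp [act_eq, whiskerLeft_objAct]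

lemma act_whiskerRight {Y Z : S.Obj} (f : Y ⟶ Z) (a : S.A) (X : S.Obj) :
    S.act f a ▷ X = S.act (f ▷ X) a := by
  simp [act_eq, objAct_whiskerRight]

lemma act_tensorHom {X Y X' Y' : S.Obj} (f : X ⟶ Y) (g : X' ⟶ Y') (a b : S.A) :
    S.act f a ⊗ₘ S.act g b = S.act (f ⊗ₘ g) (a * b) := by
  simp only [MonoidalCategory.tensorHom_def, act_whiskerRight, whiskerLeft_act, act_comp]

variable {B : CommGrpCat.{u}} (φ : S.A ⟶ B)

/-- The relation `(f • a, b) ∼ (f, φ(a) b)` on pairs of an arrow of `𝒢` and an element of `B`. -/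
def pairSetoid (X Y : S.Obj) : Setoid ((X ⟶ Y) × B) where
  r x y := ∃ a : S.A, x.1 = S.act y.1 a ∧ y.2 = φ a * x.2
  iseqv :=
    { refl := fun x => ⟨1, by simp [act_one]⟩
      symm := by
        rintro ⟨f, b⟩ ⟨f', b'⟩ ⟨a, h1, h2⟩
        refine ⟨a⁻¹, ?_, ?_⟩
        · dsimp only at h1 ⊢
          rw [h1, ← act_mul, mul_inv_cancel, act_one]
        · dsimp only at h2 ⊢
          rw [h2]
          simp
      trans := by
        rintro ⟨f, b⟩ ⟨f', b'⟩ ⟨f'', b''⟩ ⟨a, h1, h2⟩ ⟨c, h3, h4⟩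
        refine ⟨c * a, ?_, ?_⟩
        · dsimp only at h1 h3 ⊢
          rw [h1, h3, act_mul]
        · dsimp only at h2 h4 ⊢
          rw [h4, h2, map_mul, mul_assoc] }

/-- The objects of `𝒢[φ]` are those of `𝒢`. -/
@[ext]
structure PushoutObj (φ : S.A ⟶ B) : Type u where
  /-- the underlying object of `𝒢` -/
  as : S.Obj

namespace PushoutObj

variable {S φ}

/-- The arrows of `𝒢[φ]` are the classes of pairs `(f, b)`. -/
instance : CategoryStruct (S.PushoutObj φ) where
  Hom X Y := Quotient (S.pairSetoid φ X.as Y.as)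
  id X := Quotient.mk _ (𝟙 X.as, 1)
  comp {X Y Z} := Quotient.map₂ (fun x y => (x.1 ≫ y.1, x.2 * y.2)) (by
    rintro ⟨f, b⟩ ⟨f', b'⟩ ⟨a, h1, h2⟩ ⟨g, c⟩ ⟨g', c'⟩ ⟨d, h3, h4⟩
    dsimp only at h1 h2 h3 h4
    exact ⟨a * d, by simp only [h1, h3, act_comp],
      by simp only [h2, h4, map_mul]; rw [mul_mul_mul_comm]⟩)

/-- The arrow of `𝒢[φ]` represented by the pair `(f, b)`. -/
def homMk {X Y : S.PushoutObj φ} (f : X.as ⟶ Y.as) (b : B) : X ⟶ Y :=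
  Quotient.mk (S.pairSetoid φ X.as Y.as) (f, b)

lemma homMk_surj {X Y : S.PushoutObj φ} (x : X ⟶ Y) : ∃ f b, x = homMk f b := by
  induction x using Quotient.inductionOn with
  | h x => exact ⟨x.1, x.2, rfl⟩

lemma homMk_eq_iff {X Y : S.PushoutObj φ} (f f' : X.as ⟶ Y.as) (b b' : B) :
    (homMk f b : X ⟶ Y) = homMk f' b' ↔ ∃ a : S.A, f = S.act f' a ∧ b' = φ a * b :=
  Quotient.eq (r := S.pairSetoid φ X.as Y.as)

lemma id_eq_homMk (X : S.PushoutObj φ) : 𝟙 X = homMk (𝟙 X.as) 1 := rfl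

lemma homMk_comp {X Y Z : S.PushoutObj φ} (f : X.as ⟶ Y.as) (g : Y.as ⟶ Z.as) (b c : B) :
    (homMk f b : X ⟶ Y) ≫ (homMk g c : Y ⟶ Z) = homMk (f ≫ g) (b * c) := rfl

instance : Category (S.PushoutObj φ) where
  id_comp x := by
    obtain ⟨f, b, rfl⟩ := homMk_surj x
    rw [id_eq_homMk, homMk_comp, Category.id_comp, one_mul]
  comp_id x := by
    obtain ⟨f, b, rfl⟩ := homMk_surj x
    rw [id_eq_homMk, homMk_comp, Category.comp_id, mul_one]
  assoc x y z := by
    obtain ⟨f, b, rfl⟩ := homMk_surj x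
    obtain ⟨g, c, rfl⟩ := homMk_surj y
    obtain ⟨h, d, rfl⟩ := homMk_surj z
    simp only [homMk_comp, Category.assoc, mul_assoc]

/-- An isomorphism of `𝒢` as an isomorphism of `𝒢[φ]`. -/
def mkIso {X Y : S.PushoutObj φ} (e : X.as ≅ Y.as) : X ≅ Y where
  hom := homMk e.hom 1
  inv := homMk e.inv 1
  hom_inv_id := by rw [homMk_comp, e.hom_inv_id, one_mul, id_eq_homMk]
  inv_hom_id := by rw [homMk_comp, e.inv_hom_id, one_mul, id_eq_homMk]

instance : MonoidalCategoryStruct (S.PushoutObj φ) where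
  tensorObj X Y := ⟨X.as ⊗ Y.as⟩
  tensorUnit := ⟨𝟙_ S.Obj⟩
  whiskerLeft X _ _ := Quotient.map (fun x => (X.as ◁ x.1, x.2)) (by
    rintro ⟨f, b⟩ ⟨f', b'⟩ ⟨a, h1, h2⟩
    dsimp only at h1 h2
    exact ⟨a, by simp only [h1, whiskerLeft_act], h2⟩)
  whiskerRight x Y := Quotient.map (fun x => (x.1 ▷ Y.as, x.2)) (by
    rintro ⟨f, b⟩ ⟨f', b'⟩ ⟨a, h1, h2⟩
    dsimp only at h1 h2
    exact ⟨a, by simp only [h1, act_whiskerRight], h2⟩) x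
  tensorHom := Quotient.map₂ (fun x y => (x.1 ⊗ₘ y.1, x.2 * y.2)) (by
    rintro ⟨f, b⟩ ⟨f', b'⟩ ⟨a, h1, h2⟩ ⟨g, c⟩ ⟨g', c'⟩ ⟨d, h3, h4⟩
    dsimp only at h1 h2 h3 h4
    exact ⟨a * d, by simp only [h1, h3, act_tensorHom],
      by simp only [h2, h4, map_mul]; rw [mul_mul_mul_comm]⟩)
  associator X Y Z := mkIso (α_ X.as Y.as Z.as)
  leftUnitor X := mkIso (λ_ X.as)
  rightUnitor X := mkIso (ρ_ X.as)

lemma homMk_tensorHom {X Y X' Y' : S.PushoutObj φ} (f : X.as ⟶ Y.as) (g : X'.as ⟶ Y'.as) (b c : B) :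
    (homMk f b : X ⟶ Y) ⊗ₘ (homMk g c : X' ⟶ Y') = homMk (f ⊗ₘ g) (b * c) := rfl

lemma whiskerLeft_homMk (X : S.PushoutObj φ) {Y Z : S.PushoutObj φ} (f : Y.as ⟶ Z.as) (b : B) :
    X ◁ (homMk f b : Y ⟶ Z) = homMk (X.as ◁ f) b := rfl

lemma homMk_whiskerRight (X : S.PushoutObj φ) {Y Z : S.PushoutObj φ} (f : Y.as ⟶ Z.as) (b : B) :
    (homMk f b : Y ⟶ Z) ▷ X = homMk (f ▷ X.as) b := rfl

lemma homMk_congr {X Y : S.PushoutObj φ} {f f' : X.as ⟶ Y.as} {b b' : B} (h : f = f') (h' : b = b') :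
    (homMk f b : X ⟶ Y) = homMk f' b' := by rw [h, h']

/-- The multiplication data of `𝒢[φ]` are inherited from `𝒢`. -/
instance : MonoidalCategory (S.PushoutObj φ) where
  tensorHom_def x y := by
    obtain ⟨f, b, rfl⟩ := homMk_surj x
    obtain ⟨g, c, rfl⟩ := homMk_surj y
    exact homMk_congr (MonoidalCategory.tensorHom_def f g) rfl
  id_tensorHom_id X Y := homMk_congr (id_tensorHom_id X.as Y.as) (one_mul 1)
  tensorHom_comp_tensorHom x y z w := by
    obtain ⟨f, b, rfl⟩ := homMk_surj x
    obtain ⟨g, c, rfl⟩ := homMk_surj y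
    obtain ⟨h, d, rfl⟩ := homMk_surj z
    obtain ⟨k, e, rfl⟩ := homMk_surj w
    exact homMk_congr (tensorHom_comp_tensorHom f g h k) (mul_mul_mul_comm _ _ _ _)
  whiskerLeft_id X Y := homMk_congr (whiskerLeft_id X.as Y.as) rfl
  id_whiskerRight X Y := homMk_congr (id_whiskerRight X.as Y.as) rfl
  associator_naturality x y z := by
    obtain ⟨f, b, rfl⟩ := homMk_surj x
    obtain ⟨g, c, rfl⟩ := homMk_surj y
    obtain ⟨h, d, rfl⟩ := homMk_surj z
    exact homMk_congr (associator_naturality f g h) (by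
      dsimp only
      rw [mul_one, one_mul, mul_assoc])
  leftUnitor_naturality x := by
    obtain ⟨f, b, rfl⟩ := homMk_surj x
    exact homMk_congr (leftUnitor_naturality f) (by rw [mul_one, one_mul])
  rightUnitor_naturality x := by
    obtain ⟨f, b, rfl⟩ := homMk_surj x
    exact homMk_congr (rightUnitor_naturality f) (by rw [mul_one, one_mul])
  pentagon X Y Z W := homMk_congr (pentagon X.as Y.as Z.as W.as) (by simp only [one_mul])
  triangle X Y := homMk_congr (triangle X.as Y.as) (by simp only [one_mul])

end PushoutObj

open PushoutObj

/-- The central categorical extension `1//B → 𝒢[φ] → G` associated to `𝒢` via `φ`. -/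
noncomputable def pushoutExtension : CategoricalCentralExtension G where
  A := B
  Obj := S.PushoutObj φ
  isCategoricalGroup :=
    { isGroupoid := ⟨fun {X Y} x => by
        obtain ⟨f, b, rfl⟩ := homMk_surj x
        have := S.isCategoricalGroup.isGroupoid
        refine ⟨homMk (inv f) b⁻¹, ?_, ?_⟩
        · rw [homMk_comp, IsIso.hom_inv_id, mul_inv_cancel, id_eq_homMk]
        · rw [homMk_comp, IsIso.inv_hom_id, inv_mul_cancel, id_eq_homMk]⟩
      exists_weakInverse := fun X => by
        obtain ⟨Y, ⟨e⟩, ⟨e'⟩⟩ := S.isCategoricalGroup.exists_weakInverse X.as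
        exact ⟨⟨Y⟩, ⟨mkIso e⟩, ⟨mkIso e'⟩⟩ }
  ι := MulEquiv.ofBijective
    ({ toFun := fun b => homMk (𝟙 _) b
       map_one' := rfl
       map_mul' := fun b c => by
        change _ = (homMk (𝟙 _) c : 𝟙_ (S.PushoutObj φ) ⟶ _) ≫ homMk (𝟙 _) b
        rw [homMk_comp, Category.comp_id, mul_comm] } : B →* End (𝟙_ (S.PushoutObj φ))) (by
    constructor
    · intro b b' h
      obtain ⟨a, h1, h2⟩ := (homMk_eq_iff _ _ _ _).1 h
      have ha : a = 1 := by
        rw [act_eq, Category.id_comp] at h1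
        have h3 : S.unitEnd a = 𝟙 _ := by
          rw [← objAct_unit]
          exact h1.symm
        exact S.ι.injective (h3.trans S.unitEnd_one.symm)
      rw [h2, ha, map_one, one_mul]
    · intro x
      obtain ⟨f, b, rfl⟩ := homMk_surj (X := 𝟙_ (S.PushoutObj φ)) (Y := 𝟙_ (S.PushoutObj φ)) x
      obtain ⟨a, ha⟩ := S.ι.surjective f
      refine ⟨φ a * b, ((homMk_eq_iff _ _ _ _).2 ⟨a, ?_, rfl⟩).symm⟩
      rw [act_eq, Category.id_comp]
      exact ha.symm.trans (S.objAct_unit a).symm)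
  p X := S.p X.as
  p_tensor X Y := S.p_tensor X.as Y.as
  p_surjective g := by
    obtain ⟨X, hX⟩ := S.p_surjective g
    exact ⟨⟨X⟩, hX⟩
  p_eq_iff X Y := by
    rw [S.p_eq_iff]
    constructor
    · rintro ⟨e⟩
      exact ⟨mkIso e⟩
    · rintro ⟨e⟩
      obtain ⟨f, b, hf⟩ := homMk_surj e.hom
      have := S.isCategoricalGroup.isGroupoid
      exact ⟨asIso f⟩
  central b X := by
    change (homMk (λ_ X.as).inv 1 : X ⟶ 𝟙_ _ ⊗ X) ≫ (homMk (𝟙 _) b : 𝟙_ _ ⟶ 𝟙_ _) ▷ X ≫ homMk (λ_ X.as).hom 1 =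
      (homMk (ρ_ X.as).inv 1 : X ⟶ X ⊗ 𝟙_ _) ≫ X ◁ (homMk (𝟙 _) b : 𝟙_ _ ⟶ 𝟙_ _) ≫ homMk (ρ_ X.as).hom 1
    simp only [homMk_whiskerRight, whiskerLeft_homMk, homMk_comp]
    refine homMk_congr ?_ rfl
    change (λ_ X.as).inv ≫ 𝟙 (𝟙_ S.Obj) ▷ X.as ≫ (λ_ X.as).hom =
      (ρ_ X.as).inv ≫ X.as ◁ 𝟙 (𝟙_ S.Obj) ≫ (ρ_ X.as).hom
    simp

variable {S φ}

/-- The functor `𝒢[φ] ⥤ 𝒢[φ']`, `[f, b] ↦ [f, ψ b]`, for `ψ : B → C` under `A`. -/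
def pushoutFunctor {C : CommGrpCat.{u}} {φ' : S.A ⟶ C} (ψ : B ⟶ C) (w : φ ≫ ψ = φ') :
    S.PushoutObj φ ⥤ S.PushoutObj φ' where
  obj X := ⟨X.as⟩
  map := Quotient.map (fun x => (x.1, ψ x.2)) (by
    subst w
    rintro ⟨f, b⟩ ⟨f', b'⟩ ⟨a, h1, h2⟩
    dsimp only at h1 h2
    exact ⟨a, h1, by simp [h2]⟩)
  map_id X := homMk_congr rfl (map_one ψ.hom)
  map_comp x y := by
    obtain ⟨f, b, rfl⟩ := homMk_surj x
    obtain ⟨g, c, rfl⟩ := homMk_surj y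
    exact homMk_congr rfl (map_mul ψ.hom b c)

section

variable {C : CommGrpCat.{u}} {φ' : S.A ⟶ C} (ψ : B ⟶ C) (w : φ ≫ ψ = φ')

lemma pushoutFunctor_map_homMk {X Y : S.PushoutObj φ} (f : X.as ⟶ Y.as) (b : B) :
    (pushoutFunctor ψ w).map (homMk f b : X ⟶ Y) =
      (homMk f (ψ b) : (pushoutFunctor ψ w).obj X ⟶ (pushoutFunctor ψ w).obj Y) := rfl

instance pushoutFunctorMonoidal : (pushoutFunctor ψ w).Monoidal :=
  Functor.CoreMonoidal.toMonoidal
    { εIso := mkIso (Iso.refl (𝟙_ S.Obj))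
      μIso := fun X Y => mkIso (Iso.refl (X.as ⊗ Y.as))
      μIso_hom_natural_left := fun {X Y} x X' => by
        obtain ⟨f, b, rfl⟩ := homMk_surj x
        exact homMk_congr ((Category.comp_id _).trans (Category.id_comp _).symm)
          ((mul_one _).trans (one_mul _).symm)
      μIso_hom_natural_right := fun {X Y} X' x => by
        obtain ⟨f, b, rfl⟩ := homMk_surj x
        exact homMk_congr ((Category.comp_id _).trans (Category.id_comp _).symm)
          ((mul_one _).trans (one_mul _).symm)
      associativity := fun X Y Z => by
        refine homMk_congr (Y := ⟨X.as ⊗ Y.as ⊗ Z.as⟩)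
          (f := 𝟙 (X.as ⊗ Y.as) ▷ Z.as ≫ 𝟙 _ ≫ (α_ X.as Y.as Z.as).hom)
          (f' := (α_ X.as Y.as Z.as).hom ≫ X.as ◁ 𝟙 (Y.as ⊗ Z.as) ≫ 𝟙 _) ?_ ?_
        · simp
        · simp
      left_unitality := fun X => by
        refine homMk_congr (φ := φ') (Y := ⟨X.as⟩) (f := (λ_ X.as).hom)
          (f' := 𝟙 (𝟙_ S.Obj) ▷ X.as ≫ 𝟙 _ ≫ (λ_ X.as).hom)
          (b := 1) (b' := (1 : C) * ((1 : C) * ψ (1 : B))) ?_ ?_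
        · simp
        · simp
      right_unitality := fun X => by
        refine homMk_congr (φ := φ') (Y := ⟨X.as⟩) (f := (ρ_ X.as).hom)
          (f' := X.as ◁ 𝟙 (𝟙_ S.Obj) ≫ 𝟙 _ ≫ (ρ_ X.as).hom)
          (b := 1) (b' := (1 : C) * ((1 : C) * ψ (1 : B))) ?_ ?_
        · simp
        · simp }

variable (S)

/-- The 1-morphism `𝒢[φ] → 𝒢[φ']` of central categorical extensions given by `ψ`. -/
noncomputable def pushoutMap : S.pushoutExtension φ ⟶ S.pushoutExtension φ' :=
  @Hom.mk G _ (S.pushoutExtension φ) (S.pushoutExtension φ') ψ (pushoutFunctor ψ w)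
    (pushoutFunctorMonoidal ψ w)
    (fun b => by
      change (homMk (𝟙 (𝟙_ S.Obj)) 1 : 𝟙_ (S.PushoutObj φ') ⟶ 𝟙_ (S.PushoutObj φ')) ≫
        (homMk (𝟙 (𝟙_ S.Obj)) (ψ b) : 𝟙_ (S.PushoutObj φ') ⟶ 𝟙_ (S.PushoutObj φ')) =
        (homMk (𝟙 (𝟙_ S.Obj)) (ψ b) : 𝟙_ (S.PushoutObj φ') ⟶ 𝟙_ (S.PushoutObj φ')) ≫
        (homMk (𝟙 (𝟙_ S.Obj)) 1 : 𝟙_ (S.PushoutObj φ') ⟶ 𝟙_ (S.PushoutObj φ'))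
      rw [homMk_comp, homMk_comp, one_mul, mul_one])
    (fun X => rfl)

/-- The components of `eqToHom` between 1-morphisms given by equal homomorphisms. -/
lemma eqToHom_pushoutMap {ψ ψ' : B ⟶ C} (w : φ ≫ ψ = φ') (w' : φ ≫ ψ' = φ') (h : ψ = ψ')
    (h' : S.pushoutMap ψ w = S.pushoutMap ψ' w') (X : S.PushoutObj φ) :
    (Hom₂.τ (eqToHom h')).app X =
      (homMk (𝟙 X.as) 1 : (PushoutObj.mk X.as : S.PushoutObj φ') ⟶ PushoutObj.mk X.as) := by
  subst h
  rfl

variable {S}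

/-- The natural isomorphism `𝒢[𝟙] ≅ 𝟭`, with identity components. -/
def pushoutFunctorId (w : φ ≫ 𝟙 B = φ) : pushoutFunctor (𝟙 B) w ≅ 𝟭 (S.PushoutObj φ) :=
  NatIso.ofComponents (fun X => mkIso (Iso.refl X.as)) (fun {X Y} x => by
    obtain ⟨f, b, rfl⟩ := homMk_surj x
    exact homMk_congr ((Category.comp_id _).trans (Category.id_comp _).symm)
      ((mul_one _).trans (one_mul _).symm))

instance pushoutFunctorId_isMonoidal (w : φ ≫ 𝟙 B = φ) :
    NatTrans.IsMonoidal (pushoutFunctorId w).hom where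
  unit := homMk_congr (X := ⟨𝟙_ S.Obj⟩) (Y := ⟨𝟙_ S.Obj⟩) (Category.comp_id _) (one_mul (1 : B))
  tensor X Y := by
    refine homMk_congr (X := ⟨X.as ⊗ Y.as⟩) (Y := ⟨X.as ⊗ Y.as⟩) (f := 𝟙 _ ≫ 𝟙 _)
      (f' := (𝟙 X.as ⊗ₘ 𝟙 Y.as) ≫ 𝟙 _) (b := (1 : B) * 1) (b' := (1 * 1 : B) * 1) ?_ ?_
    · simp
    · simp

/-- The natural isomorphism `𝒢[ψ ≫ χ] ≅ 𝒢[ψ] ⋙ 𝒢[χ]`, with identity components. -/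
def pushoutFunctorComp {D : CommGrpCat.{u}} {φ'' : S.A ⟶ D} (χ : C ⟶ D)
    (w' : φ' ≫ χ = φ'') (w'' : φ ≫ ψ ≫ χ = φ'') :
    pushoutFunctor (ψ ≫ χ) w'' ≅ pushoutFunctor ψ w ⋙ pushoutFunctor χ w' :=
  NatIso.ofComponents (fun X => mkIso (Iso.refl X.as)) (fun {X Y} x => by
    obtain ⟨f, b, rfl⟩ := homMk_surj x
    exact homMk_congr ((Category.comp_id _).trans (Category.id_comp _).symm)
      ((mul_one _).trans (one_mul _).symm))

instance pushoutFunctorComp_isMonoidal {D : CommGrpCat.{u}} {φ'' : S.A ⟶ D} (χ : C ⟶ D)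
    (w' : φ' ≫ χ = φ'') (w'' : φ ≫ ψ ≫ χ = φ'') :
    NatTrans.IsMonoidal (pushoutFunctorComp ψ w χ w' w'').hom where
  unit := by
    refine homMk_congr (X := ⟨𝟙_ S.Obj⟩) (Y := ⟨𝟙_ S.Obj⟩) (f := 𝟙 _ ≫ 𝟙 _)
      (f' := 𝟙 _ ≫ 𝟙 _) (b := (1 : D) * 1) (b' := (1 : D) * χ (1 : C)) rfl ?_
    simp
  tensor X Y := by
    refine homMk_congr (X := ⟨X.as ⊗ Y.as⟩) (Y := ⟨X.as ⊗ Y.as⟩) (f := 𝟙 _ ≫ 𝟙 _)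
      (f' := (𝟙 X.as ⊗ₘ 𝟙 Y.as) ≫ 𝟙 _ ≫ 𝟙 _) (b := (1 : D) * 1)
      (b' := (1 * 1 : D) * (1 * χ (1 : C))) ?_ ?_
    · simp
    · simp

variable (S)

/-- The invertible 2-morphism `𝒢[𝟙] ≅ 𝟙`. -/
noncomputable def pushoutMapId (w : φ ≫ 𝟙 B = φ) :
    S.pushoutMap (𝟙 B) w ≅ 𝟙 (S.pushoutExtension φ) :=
  @isoMk G _ (S.pushoutExtension φ) (S.pushoutExtension φ) (S.pushoutMap (𝟙 B) w)
    (𝟙 (S.pushoutExtension φ)) (pushoutFunctorId w) (pushoutFunctorId_isMonoidal w)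

/-- The invertible 2-morphism `𝒢[ψ ≫ χ] ≅ 𝒢[ψ] ≫ 𝒢[χ]`. -/
noncomputable def pushoutMapComp {D : CommGrpCat.{u}} {φ'' : S.A ⟶ D} (χ : C ⟶ D)
    (w' : φ' ≫ χ = φ'') (w'' : φ ≫ ψ ≫ χ = φ'') :
    S.pushoutMap (ψ ≫ χ) w'' ≅ S.pushoutMap ψ w ≫ S.pushoutMap χ w' :=
  @isoMk G _ (S.pushoutExtension φ) (S.pushoutExtension φ'') (S.pushoutMap (ψ ≫ χ) w'')
    (S.pushoutMap ψ w ≫ S.pushoutMap χ w') (pushoutFunctorComp ψ w χ w' w'')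
    (pushoutFunctorComp_isMonoidal ψ w χ w' w'')

end

variable (S)

/-- For `i : A → H` the pseudofunctor `𝒢[-] : H ↓ Ab ⥤ ℰxt(G)` sending `φ : H → B` to the central
categorical extension associated to `𝒢` via `A → H → B`. The category `H ↓ Ab` is regarded as a
bicategory with only identity 2-morphisms. -/
noncomputable def pushout {H : CommGrpCat.{u}} (i : S.A ⟶ H) :
    Pseudofunctor (LocallyDiscrete (Under H)) (CategoricalCentralExtension G) :=
  pseudofunctorOfIsLocallyDiscrete
    (fun X => S.pushoutExtension (B := X.as.right) (i ≫ X.as.hom))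
    (fun {X Y} f => S.pushoutMap (B := X.as.right) (C := Y.as.right) f.as.right (by
      rw [Category.assoc, Under.w]))
    (fun X => S.pushoutMapId (B := X.as.right) (Category.comp_id _))
    (fun {X Y Z} f g => S.pushoutMapComp (B := X.as.right) (C := Y.as.right) (D := Z.as.right)
      f.as.right (by rw [Category.assoc, Under.w]) g.as.right (by rw [Category.assoc, Under.w])
      (by rw [← Category.assoc, Category.assoc i, Under.w, Category.assoc, Under.w]))
    (fun {X₀ X₁ X₂ X₃} f g h => by
      apply hom₂_ext
      intro X
      refine Eq.trans ?_ (eqToHom_pushoutMap S (B := X₀.as.right) (C := X₃.as.right) _ _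
        (congrArg (fun k : X₀ ⟶ X₃ => k.as.right) (Category.assoc f g h)) _ X).symm
      refine homMk_congr (φ := i ≫ X₃.as.hom) (f := 𝟙 _ ≫ 𝟙 _ ≫ 𝟙 _ ≫ 𝟙 _ ≫ 𝟙 _)
        (b := (1 : X₃.as.right) * (h.as.right (1 : X₂.as.right) * (1 * (1 * 1)))) ?_ ?_
      · simp; rfl
      · simp)
    (fun {X₀ X₁} f => by
      apply hom₂_ext
      intro X
      refine Eq.trans ?_ (eqToHom_pushoutMap S (B := X₀.as.right) (C := X₁.as.right) _ _
        (congrArg (fun k : X₀ ⟶ X₁ => k.as.right) (Category.id_comp f)) _ X).symm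
      refine homMk_congr (φ := i ≫ X₁.as.hom) (f := 𝟙 _ ≫ 𝟙 _ ≫ 𝟙 _)
        (b := (1 : X₁.as.right) * (f.as.right (1 : X₀.as.right) * 1)) ?_ ?_
      · simp; rfl
      · simp)
    (fun {X₀ X₁} f => by
      apply hom₂_ext
      intro X
      refine Eq.trans ?_ (eqToHom_pushoutMap S (B := X₀.as.right) (C := X₁.as.right) _ _
        (congrArg (fun k : X₀ ⟶ X₁ => k.as.right) (Category.comp_id f)) _ X).symm
      refine homMk_congr (φ := i ≫ X₁.as.hom) (f := 𝟙 _ ≫ 𝟙 _ ≫ 𝟙 _)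
        (b := (1 : X₁.as.right) * (1 * 1)) ?_ ?_
      · simp; rfl
      · simp)

end Pushout

/-- A categorical Schur cover of `G` is an initial object of the bicategory `ℰxt(G)`: to every
object there is a 1-morphism, and any two of those are related by a unique 2-isomorphism. -/
def IsCategoricalSchurCover (S : CategoricalCentralExtension G) : Prop :=
  ∀ T : CategoricalCentralExtension G, Nonempty (S ⟶ T) ∧
    ∀ f g : S ⟶ T, Nonempty (Unique (f ≅ g))

end CategoricalCentralExtension

/-- A pseudofunctor is an equivalence of bicategories (a biequivalence) if it is essentially
surjective on objects up to equivalence and an equivalence on all categories of 1-morphisms. -/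
structure CategoryTheory.Pseudofunctor.IsBiequivalence {B C : Type*} [Bicategory B] [Bicategory C]
    (F : Pseudofunctor B C) : Prop where
  essSurj : ∀ c : C, ∃ b : B, Nonempty (Bicategory.Equivalence (F.obj b) c)
  isEquivalence : ∀ a b : B, (F.mapFunctor a b).IsEquivalence

/-!
The theorem says that the universal central (categorical) extension of `G` is governed by a
universal cocycle with values in `H₂(G)` (respectively `H₃(G)`), so the proof has three ingredients.

*The universal cocycle.* Let `C` be the complex of inhomogeneous chains of `G`. If `G` is perfect,
the differential `C₂ → C₁` is surjective and, as `C₁` is free, has a section; if moreover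
`H₂(G) = 0`, this section extends to a contracting homotopy `s : C₂ → C₃` one degree further. From a homotopy
with `d s d = d` one gets a retraction `1 - s d` of chains onto cycles, hence a map
`r : Cₙ₊₁ → Hₙ₊₁(G)` that kills boundaries (`TrivialChains.exists_retraction`). On generators, `r` is a cocycle
`u` for which every cocycle with values in a trivial module `A` is, up to a coboundary, `φ ∘ u` for
a unique `φ : Hₙ₊₁(G) → A` (`exists_universal_cocycle₂`, `exists_universal_cocycle₃`).

*From cocycles to extensions.* The 2-cocycle `u` makes `H₂(G) × G` into a central extension, and the
3-cocycle `u` is the associator of a skeletal categorical group with objects `G` and automorphism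
groups `H₃(G)`. To map it to an arbitrary central categorical extension, choose an object over every
`g ∈ G` and isomorphisms `X g ⊗ X h ≅ X (g h)`, a *multiplicative system*. Since the arrows between
isomorphic objects form a torsor under the center, such a system has an associator, which is a
3-cocycle by the pentagon identity (`MulSystem.IsAssociator.isTrivialCocycle₃`) and can be adjusted
by a coboundary to become `φ ∘ u`; it is then the same as a monoidal functor. Two such functors
differ by a 2-cochain, which turns out to be a cocycle and hence a coboundary since `H²(G, A) = 0`,
so they are isomorphic; the isomorphism is unique since `G` is perfect. Unit constraints impose no
further condition: they are determined by the tensor constraints.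

*From initial objects to equivalences.* For an initial object `S`, a map `S → T` factors through an
equivalence from the pushout of `S` along the induced map of centers, by a five lemma argument
(`isIso_of_bijective`, `Hom.nonempty_equivalence`). A map between two pushouts of `S` is determined
by its restriction to `S`, where there is no choice, and by its effect on centers. So the pushout
functor is an equivalence (`IsSchurCover.pushout_isEquivalence`,
`IsCategoricalSchurCover.pushout_isBiequivalence`).
-/

/-! ### Homology of the complex of inhomogeneous chains -/

section HomologyOfComplex

/-- Homology in the middle of `M₁ → M₂ → M₃`, as a quotient of the group of cycles. -/
lemma exists_homology_projection {R : Type*} [CommRing R] (S : ShortComplex (ModuleCat R)) :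
    ∃ π : LinearMap.ker S.g.hom →+ S.homology, Function.Surjective π ∧
      ∀ x, π x = 0 ↔ ∃ y, S.f.hom y = x.1 := by
  refine ⟨(S.moduleCatHomologyIso.inv.hom ∘ₗ Submodule.mkQ _).toAddMonoidHom, ?_, ?_⟩
  · intro z
    obtain ⟨x, hx⟩ := Submodule.mkQ_surjective _ (S.moduleCatHomologyIso.hom.hom z)
    refine ⟨x, ?_⟩
    change S.moduleCatHomologyIso.inv.hom (Submodule.mkQ _ x) = z
    rw [hx]
    exact S.moduleCatHomologyIso.hom_inv_id_apply z
  · intro x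
    change S.moduleCatHomologyIso.inv.hom (Submodule.mkQ _ x) = 0 ↔ _
    have hinj : Function.Injective S.moduleCatHomologyIso.inv.hom :=
      S.moduleCatHomologyIso.symm.toLinearEquiv.injective
    refine (map_eq_zero_iff S.moduleCatHomologyIso.inv.hom hinj).trans
      ((Submodule.Quotient.mk_eq_zero _).trans ?_)
    constructor
    · rintro ⟨y, rfl⟩
      exact ⟨y, rfl⟩
    · rintro ⟨y, hy⟩
      exact ⟨y, Subtype.ext hy⟩

end HomologyOfComplex

/-- A perfect group has no nontrivial homomorphism to an abelian group. -/
lemma eq_one_of_isPerfect {G : Type*} [Group G] (hG : Group.IsPerfect G) {A : Type*}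
    [CommGroup A] (k : G → A) (hk : ∀ g h, k (g * h) = k g * k h) (g : G) : k g = 1 := by
  have : commutator G ≤ (MonoidHom.mk' k hk).ker := Abelianization.commutator_subset_ker _
  exact this Group.IsPerfect.mem_commutator

namespace TrivialChains

variable (G : Type u)

/-- The group of inhomogeneous `n`-chains of `G` with coefficients in `ℤ`. -/
abbrev C (n : ℕ) : Type u := (Fin n → G) →₀ ULift.{u} ℤ

variable {G}

/-- The generator of the group of chains given by a tuple of group elements. -/
noncomputable def gen {n : ℕ} (x : Fin n → G) : C G n := Finsupp.single x 1

variable {A : Type*} [AddCommGroup A]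

/-- The homomorphism on chains with given values on generators. -/
noncomputable def extend {n : ℕ} (f : (Fin n → G) → A) : C G n →+ A :=
  Finsupp.liftAddHom fun x => (zmultiplesHom A (f x)).comp AddEquiv.ulift.toAddMonoidHom

@[simp]
lemma extend_gen {n : ℕ} (f : (Fin n → G) → A) (x : Fin n → G) : extend f (gen x) = f x := by
  simp only [extend, gen, Finsupp.liftAddHom_apply_single]
  exact one_zsmul (f x)

lemma hom_ext {n : ℕ} {f g : C G n →+ A} (h : ∀ x, f (gen x) = g (gen x)) : f = g := by
  refine Finsupp.addHom_ext fun x a => ?_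
  have : Finsupp.single x a = a.down • gen x := by
    rw [gen, Finsupp.smul_single]
    congr 1
    exact ULift.ext _ _ (by simp)
  rw [this, map_zsmul, map_zsmul, h]

lemma gen_eq_two (x : Fin 2 → G) : gen x = gen ![x 0, x 1] := by
  congr 1; ext i; fin_cases i <;> rfl

lemma gen_eq_three (x : Fin 3 → G) : gen x = gen ![x 0, x 1, x 2] := by
  congr 1; ext i; fin_cases i <;> rfl

lemma gen_eq_four (x : Fin 4 → G) : gen x = gen ![x 0, x 1, x 2, x 3] := by
  congr 1; ext i; fin_cases i <;> rfl

variable (G) [Group G]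

/-- The differential of the complex of inhomogeneous chains. -/
noncomputable def d (n : ℕ) : C G (n + 1) →+ C G n :=
  (groupHomology.inhomogeneousChains.d
    (Rep.trivial (ULift.{u} ℤ) G (ULift.{u} ℤ)) n).hom.toAddMonoidHom

variable {G}

lemma d_d {n : ℕ} (x : C G (n + 2)) : d G n (d G (n + 1) x) = 0 :=
  congrArg (fun f => f.hom x) (groupHomology.inhomogeneousChains.d_comp_d
    (Rep.trivial (ULift.{u} ℤ) G (ULift.{u} ℤ)) (n := n))

lemma d_gen {n : ℕ} (x : Fin (n + 1) → G) :
    d G n (gen x) = gen (fun i => x i.succ) +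
      ∑ j : Fin (n + 1), (-1 : ℤ) ^ ((j : ℕ) + 1) • gen (Fin.contractNth j (· * ·) x) := by
  have h := groupHomology.inhomogeneousChains.d_single (k := ULift.{u} ℤ)
    (A := Rep.trivial (ULift.{u} ℤ) G (ULift.{u} ℤ)) n x (1 : ULift.{u} ℤ)
  have h' (j : Fin (n + 1)) :
      (-1 : ℤ) ^ ((j : ℕ) + 1) • (gen (Fin.contractNth j (· * ·) x) : C G n) =
        (-1 : ULift.{u} ℤ) ^ ((j : ℕ) + 1) • (gen (Fin.contractNth j (· * ·) x) : C G n) := by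
    rw [← Int.cast_smul_eq_zsmul (ULift.{u} ℤ)]
    push_cast
    rfl
  simp only [h']
  exact h

/-- The `n`-th homology of `G` as a quotient of the group of `n`-cycles. -/
lemma exists_projection (n : ℕ) :
    ∃ π : (d G n).ker →+ Additive (integralHomology G (n + 1)), Function.Surjective π ∧
      ∀ x, π x = 0 ↔ ∃ y, d G (n + 1) y = x.1 := by
  let K := groupHomology.inhomogeneousChains (Rep.trivial (ULift.{u} ℤ) G (ULift.{u} ℤ))
  obtain ⟨π, h1, h2⟩ := exists_homology_projection (K.sc' (n + 2) (n + 1) n)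
  let e := (K.homologyIsoSc' (n + 2) (n + 1) n (by simp) (by simp)).toLinearEquiv
  have hd1 : (K.d (n + 1) n).hom.toAddMonoidHom = d G n := by
    rw [groupHomology.inhomogeneousChains.d_def]; rfl
  have hd2 : (K.d (n + 2) (n + 1)).hom.toAddMonoidHom = d G (n + 1) := by
    rw [groupHomology.inhomogeneousChains.d_def]; rfl
  let j : (d G n).ker →+ LinearMap.ker (K.sc' (n + 2) (n + 1) n).g.hom :=
    { toFun := fun x => ⟨x.1, (DFunLike.congr_fun hd1 x.1).trans x.2⟩
      map_zero' := rfl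
      map_add' := fun _ _ => rfl }
  refine ⟨(e.symm.toLinearMap.toAddMonoidHom.comp π).comp j, ?_, ?_⟩
  · intro z
    obtain ⟨x, hx⟩ := h1 (e z)
    refine ⟨⟨x.1, (DFunLike.congr_fun hd1 x.1).symm.trans x.2⟩, ?_⟩
    change e.symm (π x) = z
    rw [hx]
    exact e.symm_apply_apply z
  · intro x
    change e.symm (π (j x)) = 0 ↔ _
    rw [map_eq_zero_iff _ e.symm.injective, h2]
    refine exists_congr fun y => ?_
    rw [← hd2]
    rfl

lemma d_gen_two (g h : G) :
    d G 1 (gen ![g, h]) = gen ![h] - gen ![g * h] + gen ![g] := by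
  rw [d_gen, Fin.sum_univ_two]
  have h0 : (fun i : Fin 1 => (![g, h] : Fin 2 → G) i.succ) = ![h] := by
    ext i; fin_cases i; rfl
  have h1 : Fin.contractNth (0 : Fin 2) (· * ·) ![g, h] = ![g * h] := by
    ext i; fin_cases i; rfl
  have h2 : Fin.contractNth (1 : Fin 2) (· * ·) ![g, h] = ![g] := by
    ext i; fin_cases i; rfl
  rw [h0, h1, h2]
  simp [sub_eq_add_neg, add_assoc]

lemma d_gen_three (g h k : G) :
    d G 2 (gen ![g, h, k]) =
      gen ![h, k] - gen ![g * h, k] + gen ![g, h * k] - gen ![g, h] := by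
  rw [d_gen, Fin.sum_univ_three]
  have h0 : (fun i : Fin 2 => (![g, h, k] : Fin 3 → G) i.succ) = ![h, k] := by
    ext i; fin_cases i <;> rfl
  have h1 : Fin.contractNth (0 : Fin 3) (· * ·) ![g, h, k] = ![g * h, k] := by
    ext i; fin_cases i <;> rfl
  have h2 : Fin.contractNth (1 : Fin 3) (· * ·) ![g, h, k] = ![g, h * k] := by
    ext i; fin_cases i <;> rfl
  have h3 : Fin.contractNth (2 : Fin 3) (· * ·) ![g, h, k] = ![g, h] := by
    ext i; fin_cases i <;> rfl
  rw [h0, h1, h2, h3]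
  simp [sub_eq_add_neg, add_assoc, pow_succ]

lemma d_gen_four (g h k l : G) :
    d G 3 (gen ![g, h, k, l]) =
      gen ![h, k, l] - gen ![g * h, k, l] + gen ![g, h * k, l] - gen ![g, h, k * l] +
        gen ![g, h, k] := by
  rw [d_gen, Fin.sum_univ_four]
  have h0 : (fun i : Fin 3 => (![g, h, k, l] : Fin 4 → G) i.succ) = ![h, k, l] := by
    ext i; fin_cases i <;> rfl
  have h1 : Fin.contractNth (0 : Fin 4) (· * ·) ![g, h, k, l] = ![g * h, k, l] := by
    ext i; fin_cases i <;> rfl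
  have h2 : Fin.contractNth (1 : Fin 4) (· * ·) ![g, h, k, l] = ![g, h * k, l] := by
    ext i; fin_cases i <;> rfl
  have h3 : Fin.contractNth (2 : Fin 4) (· * ·) ![g, h, k, l] = ![g, h, k * l] := by
    ext i; fin_cases i <;> rfl
  have h4 : Fin.contractNth (3 : Fin 4) (· * ·) ![g, h, k, l] = ![g, h, k] := by
    ext i; fin_cases i <;> rfl
  rw [h0, h1, h2, h3, h4]
  simp [sub_eq_add_neg, add_assoc, pow_succ]

/-- For perfect `G` the differential from 2-chains to 1-chains is surjective, because `H₁(G)` vanishes,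
and it splits because the group of 1-chains is free. -/
lemma exists_section_of_isPerfect (hG : Group.IsPerfect G) :
    ∃ s : C G 1 →+ C G 2, ∀ x, d G 1 (s x) = x := by
  -- `g ↦ [g]` is a homomorphism to the abelian group of chains modulo boundaries
  let q (g : G) : Multiplicative (C G 1 ⧸ (d G 1).range) :=
    Multiplicative.ofAdd (QuotientAddGroup.mk (gen ![g]))
  have hq (g h : G) : q (g * h) = q g * q h := by
    refine (QuotientAddGroup.eq (s := (d G 1).range) (a := gen ![g * h])
      (b := gen ![g] + gen ![h])).2 ⟨gen ![g, h], ?_⟩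
    rw [d_gen_two]
    abel
  have key (g : G) : ∃ y, d G 1 y = gen ![g] :=
    (QuotientAddGroup.eq_zero_iff _).1 (eq_one_of_isPerfect hG q hq g)
  choose t ht using key
  refine ⟨extend fun x => t (x 0), fun x => ?_⟩
  refine DFunLike.congr_fun (hom_ext (f := (d G 1).comp (extend fun x => t (x 0)))
    (g := AddMonoidHom.id _) fun x => ?_) x
  have hx : x = ![x 0] := by ext i; fin_cases i; rfl
  simp only [AddMonoidHom.comp_apply, extend_gen, ht, AddMonoidHom.id_apply]
  rw [← hx]

/-- If `H₂(G)` vanishes, a section in degree one extends to a contracting homotopy one degree further: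
the complement `x - s (d x)` of a generator is a cycle, hence a boundary. -/
lemma exists_homotopy_of_subsingleton (h2 : Subsingleton (integralHomology G 2))
    (s : C G 1 →+ C G 2) (hs : ∀ x, d G 1 (s x) = x) :
    ∃ s' : C G 2 →+ C G 3, ∀ x, d G 2 (s' x) + s (d G 1 x) = x := by
  obtain ⟨π, -, hπ⟩ := exists_projection (G := G) 1
  have key (x : Fin 2 → G) : ∃ y, d G 2 y = gen x - s (d G 1 (gen x)) := by
    have hx : gen x - s (d G 1 (gen x)) ∈ (d G 1).ker := by
      rw [AddMonoidHom.mem_ker, map_sub, hs, sub_self]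
    exact (hπ ⟨_, hx⟩).1 (Subsingleton.elim (α := integralHomology G 2) _ _)
  choose t ht using key
  refine ⟨extend t, fun x => ?_⟩
  refine DFunLike.congr_fun (hom_ext (f := (d G 2).comp (extend t) + s.comp (d G 1))
    (g := AddMonoidHom.id _) fun x => ?_) x
  simp [ht]

/-- A homotopy `s` with `d s d = d` splits off the homology: the projection from cycles to
homology extends to a map `r` on all chains that kills boundaries, and `r` is universal with this
property up to maps that factor through `d`. -/
lemma exists_retraction (n : ℕ) (s : C G n →+ C G (n + 1))
    (hs : ∀ x, d G n (s (d G n x)) = d G n x) :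
    ∃ r : C G (n + 1) →+ Additive (integralHomology G (n + 1)),
      (∀ x, r (d G (n + 1) x) = 0) ∧
      (∀ z, ∃ x, d G n x = 0 ∧ r x = z) ∧
      ∀ (A : Type u) [AddCommGroup A] (c : C G (n + 1) →+ A), (∀ x, c (d G (n + 1) x) = 0) →
        ∃ φ : Additive (integralHomology G (n + 1)) →+ A,
          ∀ x, c x = φ (r x) + c (s (d G n x)) := by
  obtain ⟨π, hsurj, hπ⟩ := exists_projection (G := G) n
  let e : C G (n + 1) →+ (d G n).ker :=
    (AddMonoidHom.id _ - s.comp (d G n)).codRestrict _ fun x => by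
      simp [AddMonoidHom.mem_ker, hs]
  have he (x) (hx : d G n x = 0) : e x = ⟨x, hx⟩ := Subtype.ext (by simp [e, hx])
  have hr (x) (hx : d G n x = 0) : π (e x) = π ⟨x, hx⟩ := by rw [he x hx]
  refine ⟨π.comp e, fun x => ?_, fun z => ?_, fun A _ c hc => ?_⟩
  · exact (hr _ (d_d x)).trans ((hπ _).2 ⟨x, rfl⟩)
  · obtain ⟨x, rfl⟩ := hsurj z
    exact ⟨x.1, x.2, hr _ x.2⟩
  · refine ⟨π.liftOfSurjective hsurj ⟨c.comp (d G n).ker.subtype, fun x hx => ?_⟩, fun x => ?_⟩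
    · obtain ⟨y, hy⟩ := (hπ x).1 hx
      exact (congrArg c hy).symm.trans (hc y)
    · rw [AddMonoidHom.comp_apply, AddMonoidHom.liftOfSurjective,
        AddMonoidHom.liftOfRightInverse_comp_apply]
      simp [e]

end TrivialChains

/-! ### Universal cocycles of perfect and superperfect groups -/

section Cocycles

variable {G : Type*} [Group G] {A : Type*} [CommGroup A]

/-- A 2-cocycle of `G` with values in the trivial `G`-module `A`. -/
def IsTrivialCocycle₂ (c : G → G → A) : Prop :=
  ∀ g h k, c g h * c (g * h) k = c h k * c g (h * k)

/-- A 3-cocycle of `G` with values in the trivial `G`-module `A`. -/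
def IsTrivialCocycle₃ (c : G → G → G → A) : Prop :=
  ∀ g h k l, c g h k * c g (h * k) l * c h k l = c (g * h) k l * c g h (k * l)

/-- The coboundary of a 1-cochain. -/
def coboundary₁ (b : G → A) (g h : G) : A := b g * b h / b (g * h)

/-- The coboundary of a 2-cochain. -/
def coboundary₂ (b : G → G → A) (g h k : G) : A := b h k * b g (h * k) / (b g h * b (g * h) k)

end Cocycles

section UniversalCocycles

open TrivialChains

variable (G : Type u) [Group G]

/-- A 2-cocycle, extended linearly to chains, vanishes on boundaries. -/
lemma IsTrivialCocycle₂.extend_d {G : Type u} [Group G] {A : Type*} [CommGroup A]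
    {c : G → G → A} (hc : IsTrivialCocycle₂ c) (x : C G 3) :
    extend (fun x : Fin 2 → G => Additive.ofMul (c (x 0) (x 1))) (d G 2 x) = 0 := by
  refine DFunLike.congr_fun (hom_ext (f := (extend _).comp (d G 2)) (g := 0) fun x => ?_) x
  rw [gen_eq_three, AddMonoidHom.comp_apply, d_gen_three]
  have := congrArg Additive.ofMul (hc (x 0) (x 1) (x 2))
  simp only [ofMul_mul] at this
  simp only [map_add, map_sub, extend_gen, AddMonoidHom.zero_apply]
  linear_combination (norm := (simp; abel)) -this

/-- A 3-cocycle, extended linearly to chains, vanishes on boundaries. -/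
lemma IsTrivialCocycle₃.extend_d {G : Type u} [Group G] {A : Type*} [CommGroup A]
    {c : G → G → G → A} (hc : IsTrivialCocycle₃ c) (x : C G 4) :
    extend (fun x : Fin 3 → G => Additive.ofMul (c (x 0) (x 1) (x 2))) (d G 3 x) = 0 := by
  refine DFunLike.congr_fun (hom_ext (f := (extend _).comp (d G 3)) (g := 0) fun x => ?_) x
  rw [gen_eq_four, AddMonoidHom.comp_apply, d_gen_four]
  have := congrArg Additive.ofMul (hc (x 0) (x 1) (x 2) (x 3))
  simp only [ofMul_mul] at this
  simp only [map_add, map_sub, extend_gen, AddMonoidHom.zero_apply]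
  linear_combination (norm := (simp; abel)) this

/-- A perfect group has a 2-cocycle with values in `H₂(G)` that is universal: up to coboundaries,
every 2-cocycle is the image of it under a unique homomorphism. -/
theorem exists_universal_cocycle₂ (hG : Group.IsPerfect G) :
    ∃ u : G → G → integralHomology G 2, IsTrivialCocycle₂ u ∧
      (∀ (A : Type u) [CommGroup A] (c : G → G → A), IsTrivialCocycle₂ c →
        ∃ (φ : integralHomology G 2 →* A) (b : G → A),
          ∀ g h, c g h = φ (u g h) * coboundary₁ b g h) ∧
      ∀ (A : Type u) [CommGroup A] (φ : integralHomology G 2 →* A) (b : G → A),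
        (∀ g h, φ (u g h) = coboundary₁ b g h) → φ = 1 := by
  obtain ⟨s, hs⟩ := exists_section_of_isPerfect hG
  obtain ⟨r, hr0, hr, hrc⟩ := exists_retraction 1 s fun x => hs _
  refine ⟨fun g h => (r (gen ![g, h])).toMul, fun g h k => ?_, fun A _ c hc => ?_,
    fun A _ φ b hb => ?_⟩
  · have := hr0 (gen ![g, h, k])
    rw [d_gen_three] at this
    simp only [map_sub, map_add] at this
    refine Additive.ofMul.injective ?_
    simp only [ofMul_mul, ofMul_toMul]
    linear_combination (norm := abel) -this
  · obtain ⟨φ, hφ⟩ := hrc (Additive A) _ hc.extend_d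
    refine ⟨MonoidHom.toAdditive.symm φ,
      fun g => (extend (fun x : Fin 2 → G => Additive.ofMul (c (x 0) (x 1)))
        (s (gen ![g]))).toMul, fun g h => ?_⟩
    have := hφ (gen ![g, h])
    rw [d_gen_two] at this
    simp only [map_add, map_sub] at this
    refine Additive.ofMul.injective ?_
    simp only [ofMul_mul, ofMul_toMul, coboundary₁, ofMul_div]
    linear_combination (norm := (simp; abel)) this
  · have key : (MonoidHom.toAdditive φ).comp r =
        (extend fun x : Fin 1 → G => Additive.ofMul (b (x 0))).comp (d G 1) := by
      refine hom_ext fun x => ?_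
      have := congrArg Additive.ofMul (hb (x 0) (x 1))
      simp only [ofMul_mul, coboundary₁, ofMul_div] at this
      rw [gen_eq_two, AddMonoidHom.comp_apply, AddMonoidHom.comp_apply, d_gen_two]
      refine Eq.trans this ?_
      simp only [map_add, map_sub, extend_gen, Matrix.cons_val_zero]
      abel
    refine MonoidHom.ext fun z => ?_
    obtain ⟨x, hx, rfl⟩ := hr (Additive.ofMul z)
    exact (DFunLike.congr_fun key x).trans (by rw [AddMonoidHom.comp_apply, hx, map_zero]; rfl)

/-- The second cohomology of a superperfect group with trivial coefficients vanishes. -/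
theorem exists_eq_coboundary₁ (hG : IsSuperperfect G) {A : Type u} [CommGroup A]
    (c : G → G → A) (hc : IsTrivialCocycle₂ c) :
    ∃ b : G → A, ∀ g h, c g h = coboundary₁ b g h := by
  obtain ⟨u, -, hu, -⟩ := exists_universal_cocycle₂ G hG.1
  obtain ⟨φ, b, h⟩ := hu A c hc
  have := hG.2
  refine ⟨b, fun g k => ?_⟩
  rw [h, Subsingleton.elim (u g k) 1, map_one, one_mul]

/-- A superperfect group has a 3-cocycle with values in `H₃(G)` that is universal: up to
coboundaries, every 3-cocycle is the image of it under a unique homomorphism. -/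
theorem exists_universal_cocycle₃ (hG : IsSuperperfect G) :
    ∃ u : G → G → G → integralHomology G 3, IsTrivialCocycle₃ u ∧
      (∀ (A : Type u) [CommGroup A] (c : G → G → G → A), IsTrivialCocycle₃ c →
        ∃ (φ : integralHomology G 3 →* A) (b : G → G → A),
          ∀ g h k, c g h k = φ (u g h k) * coboundary₂ b g h k) ∧
      ∀ (A : Type u) [CommGroup A] (φ : integralHomology G 3 →* A) (b : G → G → A),
        (∀ g h k, φ (u g h k) = coboundary₂ b g h k) → φ = 1 := by
  obtain ⟨s₁, hs₁⟩ := exists_section_of_isPerfect hG.1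
  obtain ⟨s, hs⟩ := exists_homotopy_of_subsingleton hG.2 s₁ hs₁
  obtain ⟨r, hr0, hr, hrc⟩ := exists_retraction 2 s fun x => by
    have := hs (d G 2 x)
    rwa [d_d, map_zero, add_zero] at this
  refine ⟨fun g h k => (r (gen ![g, h, k])).toMul, fun g h k l => ?_, fun A _ c hc => ?_,
    fun A _ φ b hb => ?_⟩
  · have := hr0 (gen ![g, h, k, l])
    rw [d_gen_four] at this
    simp only [map_sub, map_add] at this
    refine Additive.ofMul.injective ?_
    simp only [ofMul_mul, ofMul_toMul]
    linear_combination (norm := abel) this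
  · obtain ⟨φ, hφ⟩ := hrc (Additive A) _ hc.extend_d
    refine ⟨MonoidHom.toAdditive.symm φ,
      fun g h => (extend (fun x : Fin 3 → G => Additive.ofMul (c (x 0) (x 1) (x 2)))
        (s (gen ![g, h]))).toMul, fun g h k => ?_⟩
    have := hφ (gen ![g, h, k])
    rw [d_gen_three] at this
    simp only [map_add, map_sub] at this
    refine Additive.ofMul.injective ?_
    simp only [ofMul_mul, ofMul_toMul, coboundary₂, ofMul_div]
    linear_combination (norm := (simp; abel)) this
  · have key : (MonoidHom.toAdditive φ).comp r =
        (extend fun x : Fin 2 → G => Additive.ofMul (b (x 0) (x 1))).comp (d G 2) := by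
      refine hom_ext fun x => ?_
      have := congrArg Additive.ofMul (hb (x 0) (x 1) (x 2))
      simp only [ofMul_mul, coboundary₂, ofMul_div] at this
      rw [gen_eq_three, AddMonoidHom.comp_apply, AddMonoidHom.comp_apply, d_gen_three]
      refine Eq.trans this ?_
      simp only [map_add, map_sub, extend_gen, Matrix.cons_val_zero, Matrix.cons_val_one]
      abel
    refine MonoidHom.ext fun z => ?_
    obtain ⟨x, hx, rfl⟩ := hr (Additive.ofMul z)
    exact (DFunLike.congr_fun key x).trans (by rw [AddMonoidHom.comp_apply, hx, map_zero]; rfl)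

end UniversalCocycles

/-! ### Universal central extensions -/

section TwoCocycle

variable {G : Type*} [Group G] {A : Type*} [CommGroup A] {c : G → G → A}

lemma IsTrivialCocycle₂.one_left (hc : IsTrivialCocycle₂ c) (g : G) : c 1 g = c 1 1 := by
  have := hc 1 1 g
  simp only [one_mul] at this
  exact (mul_right_cancel this).symm

lemma IsTrivialCocycle₂.one_right (hc : IsTrivialCocycle₂ c) (g : G) : c g 1 = c 1 1 := by
  have := hc g 1 1
  simp only [mul_one] at this
  exact mul_right_cancel this

/-- The set `A × G`, which a 2-cocycle `c` of `G` with values in `A` makes into a group. -/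
@[ext]
structure CocycleExtension {G A : Type*} [Group G] [CommGroup A] {c : G → G → A}
    (hc : IsTrivialCocycle₂ c) where
  /-- the component in `A` -/
  fst : A
  /-- the component in `G` -/
  snd : G

namespace CocycleExtension

variable (hc : IsTrivialCocycle₂ c)

instance : Mul (CocycleExtension hc) :=
  ⟨fun x y => ⟨x.fst * y.fst * c x.snd y.snd, x.snd * y.snd⟩⟩

instance : One (CocycleExtension hc) := ⟨⟨(c 1 1)⁻¹, 1⟩⟩

instance : Inv (CocycleExtension hc) :=
  ⟨fun x => ⟨x.fst⁻¹ * (c x.snd⁻¹ x.snd)⁻¹ * (c 1 1)⁻¹, x.snd⁻¹⟩⟩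

lemma mul_def (x y : CocycleExtension hc) :
    x * y = ⟨x.fst * y.fst * c x.snd y.snd, x.snd * y.snd⟩ := rfl

lemma one_def : (1 : CocycleExtension hc) = ⟨(c 1 1)⁻¹, 1⟩ := rfl

lemma inv_def (x : CocycleExtension hc) :
    x⁻¹ = ⟨x.fst⁻¹ * (c x.snd⁻¹ x.snd)⁻¹ * (c 1 1)⁻¹, x.snd⁻¹⟩ := rfl

instance : Group (CocycleExtension hc) :=
  Group.ofLeftAxioms
    (fun x y z => by
      simp only [mul_def, mul_assoc]
      congr 2
      have := hc x.snd y.snd z.snd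
      calc y.fst * (c x.snd y.snd * (z.fst * c (x.snd * y.snd) z.snd))
          = y.fst * z.fst * (c x.snd y.snd * c (x.snd * y.snd) z.snd) := by
            simp only [mul_assoc, mul_left_comm]
        _ = _ := by rw [this]; simp only [mul_assoc])
    (fun x => by
      simp only [mul_def, one_def, one_mul, hc.one_left]
      rw [mul_right_comm, inv_mul_cancel, one_mul])
    (fun x => by
      simp only [mul_def, one_def, inv_def, inv_mul_cancel]
      congr 1
      refine Additive.ofMul.injective ?_
      simp only [ofMul_mul, ofMul_inv]
      abel)

/-- The inclusion of `A` into the group given by a 2-cocycle. -/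
def inl : A →* CocycleExtension hc :=
  MonoidHom.mk' (fun a => ⟨a * (c 1 1)⁻¹, 1⟩) fun a b => by
    simp only [mul_def, mul_one]
    congr 1
    rw [mul_mul_mul_comm, mul_assoc (a * b), inv_mul_cancel_right]

lemma inl_def (a : A) : inl hc a = ⟨a * (c 1 1)⁻¹, 1⟩ := rfl

lemma inl_mul (a : A) (x : CocycleExtension hc) : inl hc a * x = ⟨a * x.fst, x.snd⟩ := by
  simp only [inl_def, mul_def, hc.one_left, one_mul]
  rw [mul_right_comm a, inv_mul_cancel_right]

lemma mul_inl (a : A) (x : CocycleExtension hc) : x * inl hc a = ⟨a * x.fst, x.snd⟩ := by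
  simp only [inl_def, mul_def, hc.one_right, mul_one]
  rw [← mul_assoc, inv_mul_cancel_right, mul_comm]

lemma eq_inl_mul (x : CocycleExtension hc) : x = inl hc x.fst * ⟨1, x.snd⟩ := by
  rw [inl_mul, mul_one]

lemma mk_one_mul_mk_one (g h : G) :
    (⟨1, g⟩ * ⟨1, h⟩ : CocycleExtension hc) = inl hc (c g h) * ⟨1, g * h⟩ := by
  rw [inl_mul, mul_def]
  simp

end CocycleExtension

end TwoCocycle

namespace CentralExtension

variable {G : Type u} [Group G]

lemma exists_inl_mul_of_rightHom_eq (T : CentralExtension G) {x y : T.E}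
    (h : T.ext.rightHom x = T.ext.rightHom y) : ∃ a, x = T.ext.inl a * y := by
  have : x * y⁻¹ ∈ T.ext.inl.range := by
    rw [T.ext.range_inl_eq_ker_rightHom, MonoidHom.mem_ker, map_mul, h, ← map_mul,
      mul_inv_cancel, map_one]
  obtain ⟨a, ha⟩ := this
  exact ⟨a, by rw [ha, inv_mul_cancel_right]⟩

lemma inl_mul_mul_inl_mul (T : CentralExtension G) (a b : T.A) (x y : T.E) :
    T.ext.inl a * x * (T.ext.inl b * y) = T.ext.inl (a * b) * (x * y) := by
  rw [map_mul, mul_assoc, ← mul_assoc x, ← T.central b x]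
  simp only [mul_assoc]

lemma inl_mul_cancel (T : CentralExtension G) {a b : T.A} {x : T.E}
    (h : T.ext.inl a * x = T.ext.inl b * x) : a = b :=
  T.ext.inl_injective (mul_right_cancel h)

@[simp]
lemma rightHom_inl (T : CentralExtension G) (a : T.A) : T.ext.rightHom (T.ext.inl a) = 1 := by
  have : T.ext.inl a ∈ T.ext.rightHom.ker := T.ext.range_inl_eq_ker_rightHom ▸ ⟨a, rfl⟩
  exact this

/-- The central extension `A → A × G → G` given by a 2-cocycle. -/
def ofCocycle {A : CommGrpCat.{u}} {c : G → G → A} (hc : IsTrivialCocycle₂ c) :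
    CentralExtension G where
  A := A
  E := CocycleExtension hc
  ext :=
    { inl := CocycleExtension.inl hc
      rightHom := MonoidHom.mk' CocycleExtension.snd fun _ _ => rfl
      inl_injective := fun a b h => mul_right_cancel (congrArg CocycleExtension.fst h)
      range_inl_eq_ker_rightHom := by
        ext x
        constructor
        · rintro ⟨a, rfl⟩
          rfl
        · intro h
          obtain ⟨a, g⟩ := x
          obtain rfl : g = 1 := h
          exact ⟨a * c 1 1, CocycleExtension.ext (mul_inv_cancel_right _ _) rfl⟩
      rightHom_surjective := fun g => ⟨⟨1, g⟩, rfl⟩ }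
  central a x := (CocycleExtension.inl_mul hc a x).trans (CocycleExtension.mul_inl hc a x).symm

/-- A multiplicative system of representatives, up to a given cocycle, is a map of central
extensions. -/
def homOfCocycle {A : CommGrpCat.{u}} {c : G → G → A} (hc : IsTrivialCocycle₂ c)
    (T : CentralExtension G) (φ : A ⟶ T.A) (σ : G → T.E) (hσ : ∀ g, T.ext.rightHom (σ g) = g)
    (hσ' : ∀ g h, σ g * σ h = T.ext.inl (φ (c g h)) * σ (g * h)) : ofCocycle hc ⟶ T where
  φ := φ
  f := MonoidHom.mk' (fun x : CocycleExtension hc => T.ext.inl (φ x.fst) * σ x.snd) (by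
    intro x y
    rw [inl_mul_mul_inl_mul, hσ', ← mul_assoc, ← map_mul, ← map_mul, ← map_mul]
    rfl)
  f_inl a := by
    have h1 : σ 1 = T.ext.inl (φ (c 1 1)) := by
      have := hσ' 1 1
      rw [mul_one] at this
      exact mul_right_cancel this
    change T.ext.inl (φ ((show A from a) * (c 1 1)⁻¹)) * σ 1 = _
    rw [h1, ← map_mul, ← map_mul, inv_mul_cancel_right]
    rfl
  rightHom_f x := by
    change T.ext.rightHom (T.ext.inl _ * σ x.snd) = x.snd
    rw [map_mul, hσ, rightHom_inl, one_mul]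

/-- A perfect group has a Schur cover with center `H₂(G)`. -/
theorem exists_schurCover (hG : Group.IsPerfect G) :
    ∃ S : CentralExtension G, S.IsSchurCover ∧ S.A = integralHomology G 2 := by
  obtain ⟨u, hu, hex, huniq⟩ := exists_universal_cocycle₂ G hG
  refine ⟨ofCocycle hu, ⟨Limits.IsInitial.ofUniqueHom (fun T => Classical.choice ?_) ?_⟩, rfl⟩
  · choose σ hσ using T.ext.rightHom_surjective
    have key (g h : G) : ∃ a, σ g * σ h = T.ext.inl a * σ (g * h) :=
      T.exists_inl_mul_of_rightHom_eq (by rw [map_mul, hσ, hσ, hσ])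
    choose c hc using key
    have hcoc : IsTrivialCocycle₂ c := fun g h k => by
      refine T.inl_mul_cancel (x := σ (g * h * k)) ?_
      calc _ = σ g * σ h * σ k := by rw [map_mul, mul_assoc, ← hc, ← mul_assoc, ← hc]
        _ = σ g * (T.ext.inl (c h k) * σ (h * k)) := by rw [mul_assoc, hc h k]
        _ = _ := by rw [← mul_assoc, ← T.central, mul_assoc, hc, map_mul, mul_assoc, mul_assoc g]
    obtain ⟨φ, b, hφ⟩ := hex T.A c hcoc
    refine ⟨homOfCocycle hu T (CommGrpCat.ofHom φ) (fun g => T.ext.inl (b g)⁻¹ * σ g) (fun g => ?_)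
      fun g h => ?_⟩
    · rw [map_mul, hσ, rightHom_inl, one_mul]
    · rw [inl_mul_mul_inl_mul, hc, ← mul_assoc, ← mul_assoc, ← map_mul, ← map_mul, hφ]
      congr 2
      refine Additive.ofMul.injective ?_
      simp only [coboundary₁, ofMul_mul, ofMul_inv, ofMul_div]
      change _ = Additive.ofMul (φ (u g h)) + _
      abel
  · intro T F
    suffices H : ∀ F F' : ofCocycle hu ⟶ T, F = F' from H _ _
    intro F F'
    let e (g : G) : (ofCocycle hu).E := (⟨1, g⟩ : CocycleExtension hu)
    let v (g h : G) : (ofCocycle hu).A := u g h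
    have he (g h : G) : e g * e h = (ofCocycle hu).ext.inl (v g h) * e (g * h) :=
      CocycleExtension.mk_one_mul_mk_one hu g h
    have key (g : G) : ∃ a, F.f (e g) = T.ext.inl a * F'.f (e g) :=
      T.exists_inl_mul_of_rightHom_eq (by rw [F.rightHom_f, F'.rightHom_f])
    choose k hk using key
    have hk' (g h : G) : k g * k h * F'.φ (v g h) = F.φ (v g h) * k (g * h) := by
      refine T.inl_mul_cancel (x := F'.f (e (g * h))) ?_
      have h1 := congrArg F.f (he g h)
      have h2 := congrArg F'.f (he g h)
      rw [map_mul, map_mul, F.f_inl] at h1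
      rw [map_mul, map_mul, F'.f_inl] at h2
      rw [hk, hk, hk, inl_mul_mul_inl_mul, h2, ← mul_assoc, ← mul_assoc, ← map_mul,
        ← map_mul] at h1
      exact h1
    -- the maps differ by a cochain, which shows that they agree on centers
    have hφ : F.φ.hom / F'.φ.hom = 1 := by
      refine huniq _ _ k fun g h => ?_
      change F.φ (v g h) / F'.φ (v g h) = _
      rw [coboundary₁, div_eq_div_iff_mul_eq_mul]
      exact (hk' g h).symm
    have hφ' : F.φ = F'.φ := CommGrpCat.hom_ext (div_eq_one.1 hφ)
    -- and the cochain is then a homomorphism on a perfect group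
    have hk1 := eq_one_of_isPerfect hG k fun g h => by
      have := hk' g h
      rw [hφ', mul_comm] at this
      exact (mul_left_cancel this).symm
    refine Hom.ext hφ' (MonoidHom.ext fun x => ?_)
    have hx : x = (ofCocycle hu).ext.inl (CocycleExtension.fst x) * e (CocycleExtension.snd x) :=
      CocycleExtension.eq_inl_mul hu x
    rw [hx, map_mul, map_mul, F.f_inl, F'.f_inl, hk, hk1, hφ', map_one, one_mul]

/-- The five lemma for maps of central extensions. -/
lemma isIso_of_bijective {S T : CentralExtension G} (F : S ⟶ T)
    (hF : Function.Bijective F.φ) : IsIso F := by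
  have hinj : Function.Injective F.f := by
    rw [injective_iff_map_eq_one]
    intro x hx
    have h1 := F.rightHom_f x
    rw [hx, map_one] at h1
    obtain ⟨a, rfl⟩ : x ∈ S.ext.inl.range := S.ext.range_inl_eq_ker_rightHom ▸ h1.symm
    rw [F.f_inl, ← map_one T.ext.inl] at hx
    have := T.ext.inl_injective hx
    rw [hF.1 (this.trans (map_one F.φ.hom).symm), map_one]
  have hsurj : Function.Surjective F.f := fun y => by
    obtain ⟨x, hx⟩ := S.ext.rightHom_surjective (T.ext.rightHom y)
    obtain ⟨a, ha⟩ := T.exists_inl_mul_of_rightHom_eq (hx.symm.trans (F.rightHom_f x).symm)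
    obtain ⟨a, rfl⟩ := hF.2 a
    exact ⟨S.ext.inl a * x, by rw [map_mul, F.f_inl, ha]⟩
  let e := MulEquiv.ofBijective F.f ⟨hinj, hsurj⟩
  let e' := MulEquiv.ofBijective F.φ.hom hF
  have he (x) : F.f (e.symm x) = x := e.apply_symm_apply x
  have he' (x) : F.φ (e'.symm x) = x := e'.apply_symm_apply x
  let F' : T ⟶ S :=
    { φ := CommGrpCat.ofHom e'.symm.toMonoidHom
      f := e.symm.toMonoidHom
      f_inl := fun a => hinj ((he _).trans (by
        rw [F.f_inl]
        exact congrArg T.ext.inl (he' a).symm))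
      rightHom_f := fun x => by
        rw [← F.rightHom_f]
        exact congrArg T.ext.rightHom (he x) }
  refine ⟨F', Hom.ext ?_ ?_, Hom.ext ?_ ?_⟩
  · exact CommGrpCat.hom_ext (MonoidHom.ext fun x => e'.symm_apply_apply x)
  · exact MonoidHom.ext fun x => e.symm_apply_apply x
  · exact CommGrpCat.hom_ext (MonoidHom.ext fun x => e'.apply_symm_apply x)
  · exact MonoidHom.ext fun x => e.apply_symm_apply x

section Balanced

variable (S : CentralExtension G) {B : CommGrpCat.{u}} (φ : S.A ⟶ B)

/-- The canonical map to the balanced product. -/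
def toBalanced : S ⟶ S.balancedExtension φ where
  φ := φ
  f := (QuotientGroup.mk' (S.balancedSubgroup φ)).comp (MonoidHom.inr B S.E)
  f_inl a := QuotientGroup.eq.2 ⟨a, Prod.ext ((one_mul _).symm.trans (by simp; rfl)) (by simp; rfl)⟩
  rightHom_f _ := rfl

variable {S φ}

lemma exists_eq_inl_mul_toBalanced (x : (S.balancedExtension φ).E) :
    ∃ b e, x = (S.balancedExtension φ).ext.inl b * (S.toBalanced φ).f e := by
  induction x using QuotientGroup.induction_on with
  | H x =>
    obtain ⟨b, e⟩ := x
    refine ⟨b, e, ?_⟩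
    change QuotientGroup.mk (b, e) = QuotientGroup.mk ((b, 1) * (1, e))
    simp

/-- Maps from a balanced product are determined by their restrictions to the center and to the
original extension. -/
lemma balanced_hom_ext {T : CentralExtension G} {F F' : S.balancedExtension φ ⟶ T}
    (h : F.φ = F'.φ) (h' : S.toBalanced φ ≫ F = S.toBalanced φ ≫ F') : F = F' := by
  refine Hom.ext h (MonoidHom.ext fun x => ?_)
  obtain ⟨b, e, rfl⟩ := exists_eq_inl_mul_toBalanced x
  have : F.f ((S.toBalanced φ).f e) = F'.f ((S.toBalanced φ).f e) :=
    DFunLike.congr_fun (congrArg Hom.f h') e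
  rw [map_mul, map_mul, F.f_inl, F'.f_inl, this, h]

/-- The map from the balanced product induced by a map of central extensions. -/
def ofBalanced {T : CentralExtension G} (F : S ⟶ T) (ψ : B ⟶ T.A) (w : φ ≫ ψ = F.φ) :
    S.balancedExtension φ ⟶ T where
  φ := ψ
  f := QuotientGroup.lift (S.balancedSubgroup φ)
    (MonoidHom.mk' (fun x : B × S.E => T.ext.inl (ψ x.1) * F.f x.2) (by
      intro x y
      rw [inl_mul_mul_inl_mul, ← map_mul, ← map_mul]
      rfl)) (by
      rintro _ ⟨z, rfl⟩
      change T.ext.inl (ψ (φ z)) * F.f (S.ext.inl z⁻¹) = 1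
      have hz : ψ (φ z) = F.φ z := by rw [← w]; rfl
      rw [F.f_inl, hz, ← map_mul, ← map_mul, mul_inv_cancel, map_one, map_one])
  f_inl b := by
    change T.ext.inl (ψ b) * F.f 1 = _
    rw [map_one, mul_one]
    rfl
  rightHom_f x := by
    induction x using QuotientGroup.induction_on with
    | H x =>
      change T.ext.rightHom (T.ext.inl (ψ x.1) * F.f x.2) = S.ext.rightHom x.2
      rw [map_mul, rightHom_inl, one_mul, F.rightHom_f]

/-- If `S` is initial, every central extension is a balanced product of it, in a unique way. -/
theorem IsSchurCover.pushout_isEquivalence (hS : S.IsSchurCover) {H : CommGrpCat.{u}}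
    (ι : H ≅ S.A) : (S.pushout ι.inv).IsEquivalence := by
  obtain ⟨hS⟩ := hS
  have hfaithful : (S.pushout ι.inv).Faithful :=
    ⟨fun {X Y f g} h => Under.UnderMorphism.ext (congrArg Hom.φ h)⟩
  have hfull : (S.pushout ι.inv).Full := ⟨fun {X Y} F => by
    have h : S.toBalanced (ι.inv ≫ X.hom) ≫ F = S.toBalanced (ι.inv ≫ Y.hom) := hS.hom_ext _ _
    have hφ : (ι.inv ≫ X.hom) ≫ F.φ = ι.inv ≫ Y.hom := congrArg Hom.φ h
    have hφ' : X.hom ≫ F.φ = Y.hom :=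
      (cancel_epi ι.inv).1 ((Category.assoc _ _ _).symm.trans hφ)
    refine ⟨Under.homMk F.φ hφ', balanced_hom_ext rfl (hS.hom_ext _ _)⟩⟩
  have hess : (S.pushout ι.inv).EssSurj := ⟨fun T => by
    let F : S ⟶ T := hS.to T
    let K : S.balancedExtension (ι.inv ≫ ι.hom ≫ F.φ) ⟶ T := ofBalanced F (𝟙 _) (by simp)
    have hK : IsIso K := isIso_of_bijective K Function.bijective_id
    exact ⟨Under.mk (ι.hom ≫ F.φ), ⟨@asIso _ _ _ _ K hK⟩⟩⟩
  exact {}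

end Balanced

lemma IsSchurCover.nonempty_iso {S T : CentralExtension G} (hS : S.IsSchurCover)
    (hT : T.IsSchurCover) : Nonempty (S.A ≅ T.A) := by
  obtain ⟨hS⟩ := hS
  obtain ⟨hT⟩ := hT
  have e := hS.uniqueUpToIso hT
  exact ⟨⟨e.hom.φ, e.inv.φ, congrArg Hom.φ e.hom_inv_id, congrArg Hom.φ e.inv_hom_id⟩⟩

end CentralExtension

/-! ### Arrows of a central categorical extension as a torsor under the center -/

namespace CategoricalCentralExtension

variable {G : Type u} [Group G]

section Torsor

variable (T : CategoricalCentralExtension G)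

instance : IsGroupoid T.Obj := T.isCategoricalGroup.isGroupoid

lemma act_comp_left {X Y Z : T.Obj} (f : X ⟶ Y) (g : Y ⟶ Z) (a : T.A) :
    T.act f a ≫ g = T.act (f ≫ g) a := by
  conv_lhs => rw [← T.act_one g, act_comp, mul_one]

lemma comp_act {X Y Z : T.Obj} (f : X ⟶ Y) (g : Y ⟶ Z) (a : T.A) :
    f ≫ T.act g a = T.act (f ≫ g) a := by
  conv_lhs => rw [← T.act_one f, act_comp, one_mul]

lemma act_act {X Y : T.Obj} (f : X ⟶ Y) (a b : T.A) :
    T.act (T.act f a) b = T.act f (a * b) := (T.act_mul f a b).symm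

lemma act_tensorHom_right {X Y X' Y' : T.Obj} (f : X ⟶ Y) (g : X' ⟶ Y') (a : T.A) :
    f ⊗ₘ T.act g a = T.act (f ⊗ₘ g) a := by
  conv_lhs => rw [← T.act_one f, act_tensorHom, one_mul]

lemma act_tensorHom_left {X Y X' Y' : T.Obj} (f : X ⟶ Y) (g : X' ⟶ Y') (a : T.A) :
    T.act f a ⊗ₘ g = T.act (f ⊗ₘ g) a := by
  conv_lhs => rw [← T.act_one g, act_tensorHom, mul_one]

/-- Tensoring with an object is fully faithful, because the object is weakly invertible. -/
lemma tensorLeft_fullyFaithful (X : T.Obj) :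
    (tensorLeft X).Full ∧ (tensorLeft X).Faithful := by
  obtain ⟨Y, ⟨e⟩, ⟨e'⟩⟩ := T.isCategoricalGroup.exists_weakInverse X
  have i : tensorLeft X ⋙ tensorLeft Y ≅ 𝟭 T.Obj :=
    (tensorLeftTensor Y X).symm ≪≫ (tensoringLeft T.Obj).mapIso e' ≪≫ leftUnitorNatIso T.Obj
  have i' : tensorLeft Y ⋙ tensorLeft X ≅ 𝟭 T.Obj :=
    (tensorLeftTensor X Y).symm ≪≫ (tensoringLeft T.Obj).mapIso e ≪≫ leftUnitorNatIso T.Obj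
  have h : (tensorLeft Y).Faithful :=
    have := Functor.Faithful.of_iso i'.symm
    Functor.Faithful.of_comp (tensorLeft Y) (tensorLeft X)
  have := Functor.Full.of_iso i.symm
  have := Functor.Faithful.of_iso i.symm
  exact ⟨Functor.Full.of_comp_faithful (tensorLeft X) (tensorLeft Y),
    Functor.Faithful.of_comp (tensorLeft X) (tensorLeft Y)⟩

lemma objAct_bijective (X : T.Obj) : Function.Bijective (T.objAct X) := by
  obtain ⟨h1, h2⟩ := T.tensorLeft_fullyFaithful X
  constructor
  · intro a b h
    simp only [objAct, Iso.cancel_iso_inv_left, Iso.cancel_iso_hom_right] at h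
    exact T.ι.injective ((tensorLeft X).map_injective h)
  · intro f
    obtain ⟨f', hf'⟩ := (tensorLeft X).map_surjective ((ρ_ X).hom ≫ f ≫ (ρ_ X).inv)
    obtain ⟨a, ha⟩ := T.ι.surjective f'
    refine ⟨a, ?_⟩
    have : X ◁ T.unitEnd a = (ρ_ X).hom ≫ f ≫ (ρ_ X).inv := by
      rw [← hf']
      exact congrArg (X ◁ ·) ha
    simp [objAct, this]

lemma exists_eq_act {X Y : T.Obj} (f g : X ⟶ Y) : ∃ a, g = T.act f a := by
  obtain ⟨a, ha⟩ := (T.objAct_bijective Y).2 (inv f ≫ g)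
  exact ⟨a, by simp [act_eq, ha]⟩

variable {T}

lemma act_injective {X Y : T.Obj} {f : X ⟶ Y} {a b : T.A} (h : T.act f a = T.act f b) :
    a = b := by
  rw [act_eq, act_eq, cancel_epi] at h
  exact (T.objAct_bijective Y).1 h

lemma nonempty_hom {X Y : T.Obj} (h : T.p X = T.p Y) : Nonempty (X ⟶ Y) :=
  ((T.p_eq_iff X Y).1 h).map Iso.hom

lemma p_eq_of_hom {X Y : T.Obj} (f : X ⟶ Y) : T.p X = T.p Y :=
  (T.p_eq_iff X Y).2 ⟨asIso f⟩

lemma p_unit : T.p (𝟙_ T.Obj) = 1 := by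
  have := T.p_tensor (𝟙_ _) (𝟙_ _)
  rw [p_eq_of_hom (λ_ (𝟙_ T.Obj)).hom] at this
  exact (mul_eq_left.1 this.symm)

end Torsor

section Map

variable {S T : CategoricalCentralExtension G}

lemma Hom.map_objAct (F : Hom S T) (X : S.Obj) (a : S.A) :
    F.F.map (S.objAct X a) = T.objAct (F.F.obj X) (F.φ a) := by
  have h : (ρ_ X).hom ≫ S.objAct X a = X ◁ S.unitEnd a ≫ (ρ_ X).hom := by simp [objAct]
  have h' : (ρ_ (F.F.obj X)).hom ≫ T.objAct (F.F.obj X) (F.φ a) =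
    F.F.obj X ◁ T.unitEnd (F.φ a) ≫ (ρ_ (F.F.obj X)).hom := by simp [objAct]
  have hι : Functor.LaxMonoidal.ε F.F ≫ F.F.map (S.unitEnd a) =
    T.unitEnd (F.φ a) ≫ Functor.LaxMonoidal.ε F.F := F.F_ι a
  rw [← cancel_epi (ρ_ (F.F.obj X)).hom, h', Functor.LaxMonoidal.right_unitality]
  simp only [Category.assoc]
  rw [← Functor.map_comp, h, Functor.map_comp, ← Functor.LaxMonoidal.μ_natural_right_assoc,
    ← MonoidalCategory.whiskerLeft_comp_assoc, hι, MonoidalCategory.whiskerLeft_comp_assoc]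

lemma Hom.map_act (F : Hom S T) {X Y : S.Obj} (f : X ⟶ Y) (a : S.A) :
    F.F.map (S.act f a) = T.act (F.F.map f) (F.φ a) := by
  rw [act_eq, act_eq, Functor.map_comp, map_objAct]

/-- A natural transformation that is compatible with tensor products is compatible with units:
the unit constraint of a monoidal functor is determined by its tensor constraint. -/
lemma isMonoidal_of_tensor {f g : Hom S T} (τ : f.F ⟶ g.F)
    (hτ : ∀ X Y : S.Obj, Functor.LaxMonoidal.μ f.F X Y ≫ τ.app (X ⊗ Y) =
      (τ.app X ⊗ₘ τ.app Y) ≫ Functor.LaxMonoidal.μ g.F X Y) : NatTrans.IsMonoidal τ where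
  unit := by
    obtain ⟨z, hz⟩ := T.exists_eq_act (Functor.LaxMonoidal.ε g.F)
      (Functor.LaxMonoidal.ε f.F ≫ τ.app (𝟙_ S.Obj))
    suffices z = 1 by rw [hz, this, act_one]
    refine act_injective (f := (λ_ (f.F.obj (𝟙_ S.Obj))).hom ≫ τ.app (𝟙_ S.Obj)) ?_
    rw [act_one]
    symm
    calc (λ_ (f.F.obj (𝟙_ S.Obj))).hom ≫ τ.app (𝟙_ S.Obj)
        = Functor.LaxMonoidal.ε f.F ▷ _ ≫ Functor.LaxMonoidal.μ f.F _ _ ≫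
            τ.app (𝟙_ S.Obj ⊗ 𝟙_ S.Obj) ≫ g.F.map (λ_ (𝟙_ S.Obj)).hom := by
          rw [Functor.LaxMonoidal.left_unitality]
          simp
      _ = (Functor.LaxMonoidal.ε f.F ≫ τ.app (𝟙_ S.Obj)) ▷ _ ≫ _ ◁ τ.app (𝟙_ S.Obj) ≫
            Functor.LaxMonoidal.μ g.F _ _ ≫ g.F.map (λ_ (𝟙_ S.Obj)).hom := by
          rw [reassoc_of% (hτ (𝟙_ S.Obj) (𝟙_ S.Obj)), MonoidalCategory.tensorHom_def]
          simp
      _ = T.act (_ ◁ τ.app (𝟙_ S.Obj) ≫ Functor.LaxMonoidal.ε g.F ▷ _ ≫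
            Functor.LaxMonoidal.μ g.F _ _ ≫ g.F.map (λ_ (𝟙_ S.Obj)).hom) z := by
          rw [hz, act_whiskerRight, act_comp_left, whisker_exchange_assoc]
      _ = _ := by
          rw [← Functor.LaxMonoidal.left_unitality, leftUnitor_naturality]
  tensor := hτ

end Map

/-! ### Multiplicative systems of objects and their associators -/

/-- A choice of an object over every element of `G`, and of isomorphisms between the tensor products
of these objects and the objects over the products. The product is a variable of its own in order
that different bracketings of a product can share a target. -/
structure MulSystem (T : CategoricalCentralExtension G) where
  /-- the object over an element of `G` -/
  X : G → T.Obj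
  p_X : ∀ g, T.p (X g) = g
  /-- the isomorphism with a tensor product -/
  m : ∀ {g h k : G}, g * h = k → (X g ⊗ X h ⟶ X k)

namespace MulSystem

variable {T : CategoricalCentralExtension G}

lemma nonempty (T : CategoricalCentralExtension G) : Nonempty (MulSystem T) := by
  choose X hX using T.p_surjective
  have key (g h k : G) (e : g * h = k) : Nonempty (X g ⊗ X h ⟶ X k) :=
    nonempty_hom (by rw [T.p_tensor, hX, hX, hX, e])
  exact ⟨⟨X, hX, fun {g h k} e => (key g h k e).some⟩⟩

variable (M : MulSystem T)

/-- The function `c` measures the failure of associativity of a multiplicative system: the two ways of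
multiplying three objects differ by the action of `c`. -/
def IsAssociator (c : G → G → G → T.A) : Prop :=
  ∀ {g h k gh hk ghk : G} (e₁ : g * h = gh) (e₂ : h * k = hk) (e₃ : gh * k = ghk)
    (e₄ : g * hk = ghk), (α_ (M.X g) (M.X h) (M.X k)).hom ≫ M.X g ◁ M.m e₂ ≫ M.m e₄ =
      T.act (M.m e₁ ▷ M.X k ≫ M.m e₃) (c g h k)

lemma exists_isAssociator : ∃ c, M.IsAssociator c := by
  choose c hc using fun g h k => T.exists_eq_act
    (M.m (rfl : g * h = _) ▷ M.X k ≫ M.m (rfl : _ = g * h * k))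
    ((α_ (M.X g) (M.X h) (M.X k)).hom ≫ M.X g ◁ M.m (rfl : h * k = _) ≫
      M.m (mul_assoc g h k).symm)
  refine ⟨c, ?_⟩
  rintro g h k _ _ _ rfl rfl rfl e₄
  exact hc g h k

variable {M}

/-- The pentagon identity makes the associator of a multiplicative system a 3-cocycle. -/
lemma IsAssociator.isTrivialCocycle₃ {c : G → G → G → T.A} (hc : M.IsAssociator c) :
    IsTrivialCocycle₃ c := fun g h k l => by
  have A1 := hc (rfl : g * h = _) (rfl : h * k = _) rfl (mul_assoc g h k).symm
  have A2 := hc (mul_assoc g h k).symm (rfl : h * k * l = _) (rfl : g * h * k * l = _)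
    (by simp only [mul_assoc])
  have A3 := hc (rfl : h * k = _) (rfl : k * l = _) (rfl : h * k * l = _) (mul_assoc h k l).symm
  have A4 := hc (rfl : g * h * k = _) (rfl : k * l = _) (rfl : g * h * k * l = _)
    (mul_assoc (g * h) k l).symm
  have A5 := hc (rfl : g * h = _) (mul_assoc h k l).symm (mul_assoc (g * h) k l).symm
    (show g * (h * k * l) = g * h * k * l by simp only [mul_assoc])
  refine act_injective (f := M.m (rfl : g * h = _) ▷ M.X k ▷ M.X l ≫
    M.m (rfl : g * h * k = _) ▷ M.X l ≫ M.m (rfl : g * h * k * l = _)) ?_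
  have P := pentagon (M.X g) (M.X h) (M.X k) (M.X l)
  have P' := congrArg (· ≫ M.X g ◁ M.X h ◁ M.m (rfl : k * l = _) ≫
    M.X g ◁ M.m (mul_assoc h k l).symm ≫
      M.m (show g * (h * k * l) = g * h * k * l by simp only [mul_assoc])) P
  simp only [Category.assoc] at P'
  have L : (α_ (M.X g) (M.X h) (M.X k)).hom ▷ M.X l ≫
      (α_ (M.X g) (M.X h ⊗ M.X k) (M.X l)).hom ≫
        M.X g ◁ (α_ (M.X h) (M.X k) (M.X l)).hom ≫
          M.X g ◁ M.X h ◁ M.m (rfl : k * l = _) ≫ M.X g ◁ M.m (mul_assoc h k l).symm ≫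
            M.m (show g * (h * k * l) = g * h * k * l by simp only [mul_assoc]) =
      T.act (M.m (rfl : g * h = _) ▷ M.X k ▷ M.X l ≫ M.m (rfl : g * h * k = _) ▷ M.X l ≫
        M.m (rfl : g * h * k * l = _)) (c g h k * c g (h * k) l * c h k l) := by
    rw [← MonoidalCategory.whiskerLeft_comp_assoc, ← MonoidalCategory.whiskerLeft_comp_assoc]
    simp only [Category.assoc]
    rw [A3, whiskerLeft_act]
    simp only [act_comp_left, comp_act, MonoidalCategory.whiskerLeft_comp, Category.assoc]
    rw [← associator_naturality_middle_assoc, A2]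
    simp only [comp_act, act_act]
    rw [← comp_whiskerRight_assoc, ← comp_whiskerRight_assoc, Category.assoc, A1]
    simp only [act_comp_left, act_act, act_whiskerRight, comp_whiskerRight, Category.assoc,
      mul_assoc]
  have R : (α_ (M.X g ⊗ M.X h) (M.X k) (M.X l)).hom ≫
      (α_ (M.X g) (M.X h) (M.X k ⊗ M.X l)).hom ≫
          M.X g ◁ M.X h ◁ M.m (rfl : k * l = _) ≫ M.X g ◁ M.m (mul_assoc h k l).symm ≫
            M.m (show g * (h * k * l) = g * h * k * l by simp only [mul_assoc]) =
      T.act (M.m (rfl : g * h = _) ▷ M.X k ▷ M.X l ≫ M.m (rfl : g * h * k = _) ▷ M.X l ≫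
        M.m (rfl : g * h * k * l = _)) (c (g * h) k l * c g h (k * l)) := by
    rw [← associator_naturality_right_assoc, A5]
    simp only [comp_act]
    rw [whisker_exchange_assoc, ← associator_naturality_left_assoc, A4]
    simp only [comp_act, act_act]
  exact L.symm.trans (P'.trans R)

/-- Changing the isomorphisms of a multiplicative system by a 2-cochain. -/
def twist (M : MulSystem T) (b : G → G → T.A) : MulSystem T where
  X := M.X
  p_X := M.p_X
  m {g h _} e := T.act (M.m e) (b g h)

lemma IsAssociator.twist {c c' : G → G → G → T.A} (hc : M.IsAssociator c) (b : G → G → T.A)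
    (hcc : ∀ g h k, c g h k = c' g h k * coboundary₂ b g h k) :
    (M.twist fun g h => (b g h)⁻¹).IsAssociator c' := by
  intro g h k gh hk ghk e₁ e₂ e₃ e₄
  change (α_ (M.X g) (M.X h) (M.X k)).hom ≫ M.X g ◁ T.act (M.m e₂) (b h k)⁻¹ ≫
    T.act (M.m e₄) (b g hk)⁻¹ =
      T.act (T.act (M.m e₁) (b g h)⁻¹ ▷ M.X k ≫ T.act (M.m e₃) (b gh k)⁻¹) (c' g h k)
  simp only [whiskerLeft_act, act_whiskerRight, act_comp_left, comp_act, act_act, hc e₁ e₂ e₃ e₄]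
  congr 1
  rw [hcc, coboundary₂, e₁, e₂]
  refine Additive.ofMul.injective ?_
  simp only [ofMul_mul, ofMul_inv, ofMul_div]
  abel

end MulSystem

end CategoricalCentralExtension

/-! ### The skeletal categorical group of a 3-cocycle -/

section ThreeCocycle

variable {G : Type*} [Group G] {A : Type*} [CommGroup A] {c : G → G → G → A}

lemma IsTrivialCocycle₃.one_mid (hc : IsTrivialCocycle₃ c) (g h : G) :
    c g 1 1 * c 1 1 h = c g 1 h := by
  have := hc g 1 1 h
  simp only [mul_one, one_mul] at this
  rw [mul_right_comm] at this
  exact mul_right_cancel this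

end ThreeCocycle

/-- The objects of the skeletal categorical group given by a 3-cocycle `c` of `G` with values
in `A`: the elements of `G`. -/
@[ext]
structure SkeletalObj {G A : Type u} [Group G] [CommGroup A] {c : G → G → G → A}
    (hc : IsTrivialCocycle₃ c) : Type u where
  /-- the underlying element -/
  as : G

namespace SkeletalObj

variable {G A : Type u} [Group G] [CommGroup A] {c : G → G → G → A} {hc : IsTrivialCocycle₃ c}

/-- All arrows are endomorphisms, and they are the elements of `A`. In order that objects which
are only propositionally equal have arrows between them, the equality is part of the arrow. -/
instance : Category (SkeletalObj hc) where
  Hom X Y := { _a : A // X.as = Y.as }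
  id _ := ⟨1, rfl⟩
  comp f g := ⟨f.1 * g.1, f.2.trans g.2⟩
  id_comp f := Subtype.ext (one_mul f.1)
  comp_id f := Subtype.ext (mul_one f.1)
  assoc f g h := Subtype.ext (mul_assoc f.1 g.1 h.1)

/-- The arrow given by an element of `A`. -/
def arrow {X Y : SkeletalObj hc} (a : A) (h : X.as = Y.as) : X ⟶ Y := ⟨a, h⟩

/-- The isomorphism given by an element of `A`. -/
@[simps]
def arrowIso {X Y : SkeletalObj hc} (a : A) (h : X.as = Y.as) : X ≅ Y where
  hom := arrow a h
  inv := arrow a⁻¹ h.symm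
  hom_inv_id := Subtype.ext (mul_inv_cancel a)
  inv_hom_id := Subtype.ext (inv_mul_cancel a)

instance : MonoidalCategoryStruct (SkeletalObj hc) where
  tensorObj X Y := ⟨X.as * Y.as⟩
  tensorUnit := ⟨1⟩
  whiskerLeft X _ _ f := ⟨f.1, congrArg (X.as * ·) f.2⟩
  whiskerRight f Y := ⟨f.1, congrArg (· * Y.as) f.2⟩
  tensorHom f g := ⟨f.1 * g.1, congrArg₂ (· * ·) f.2 g.2⟩
  associator X Y Z := arrowIso (c X.as Y.as Z.as) (mul_assoc _ _ _)
  leftUnitor X := arrowIso (c 1 1 X.as)⁻¹ (one_mul _)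
  rightUnitor X := arrowIso (c X.as 1 1) (mul_one _)

/-- The cocycle need not be normalized: the unit constraints make up for it. -/
instance : MonoidalCategory (SkeletalObj hc) where
  tensorHom_def _ _ := rfl
  id_tensorHom_id _ _ := Subtype.ext (one_mul (1 : A))
  tensorHom_comp_tensorHom f g h k := Subtype.ext (mul_mul_mul_comm f.1 g.1 h.1 k.1)
  whiskerLeft_id _ _ := rfl
  id_whiskerRight _ _ := rfl
  associator_naturality {X₁ X₂ X₃ Y₁ Y₂ Y₃} f g h := Subtype.ext (by
    change f.1 * g.1 * h.1 * c Y₁.as Y₂.as Y₃.as = c X₁.as X₂.as X₃.as * (f.1 * (g.1 * h.1))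
    have hf := f.2
    have hg := g.2
    have hh := h.2
    generalize f.1 = a, g.1 = b, h.1 = d
    rw [hf, hg, hh, mul_comm, mul_assoc])
  leftUnitor_naturality {X Y} f := Subtype.ext (by
    change f.1 * (c 1 1 Y.as)⁻¹ = (c 1 1 X.as)⁻¹ * f.1
    have hf := f.2
    generalize f.1 = a
    rw [hf, mul_comm])
  rightUnitor_naturality {X Y} f := Subtype.ext (by
    change f.1 * c Y.as 1 1 = c X.as 1 1 * f.1
    have hf := f.2
    generalize f.1 = a
    rw [hf, mul_comm])
  pentagon W X Y Z := Subtype.ext ((mul_assoc _ _ _).symm.trans (hc W.as X.as Y.as Z.as))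
  triangle X Y := Subtype.ext (by
    change c X.as 1 Y.as * (c 1 1 Y.as)⁻¹ = c X.as 1 1
    rw [← hc.one_mid, mul_inv_cancel_right])

end SkeletalObj

namespace CategoricalCentralExtension

open SkeletalObj

variable {G : Type u} [Group G] {A : CommGrpCat.{u}} {c : G → G → G → A}

/-- The central categorical extension given by a 3-cocycle. -/
def ofCocycle (hc : IsTrivialCocycle₃ c) : CategoricalCentralExtension G where
  A := A
  Obj := SkeletalObj hc
  isCategoricalGroup :=
    { isGroupoid := ⟨fun f => (arrowIso f.1 f.2).isIso_hom⟩
      exists_weakInverse := fun X => ⟨⟨X.as⁻¹⟩, ⟨arrowIso 1 (mul_inv_cancel _)⟩,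
        ⟨arrowIso 1 (inv_mul_cancel _)⟩⟩ }
  ι :=
    { toFun := fun a => arrow a rfl
      invFun := fun f => f.1
      left_inv := fun _ => rfl
      right_inv := fun _ => rfl
      map_mul' := fun a b => Subtype.ext (mul_comm a b) }
  p X := X.as
  p_tensor _ _ := rfl
  p_surjective g := ⟨⟨g⟩, rfl⟩
  p_eq_iff X Y := ⟨fun h => ⟨arrowIso 1 h⟩, fun ⟨e⟩ => e.hom.2⟩
  central a X := Subtype.ext (by
    change (c 1 1 X.as)⁻¹⁻¹ * (a * (c 1 1 X.as)⁻¹) = (c X.as 1 1)⁻¹ * (a * c X.as 1 1)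
    rw [mul_comm, inv_inv, inv_mul_cancel_right, mul_comm, mul_inv_cancel_right])

variable {hc : IsTrivialCocycle₃ c}

lemma ofCocycle_act {X Y : SkeletalObj hc} (f : X ⟶ Y) (a : A) :
    (ofCocycle hc).act f a = arrow (f.1 * a) f.2 := Subtype.ext (by
  change (c X.as 1 1)⁻¹ * (f.1 * a * c Y.as 1 1) = f.1 * a
  have hf := f.2
  generalize f.1 = b
  rw [hf, mul_comm, mul_inv_cancel_right])

lemma arrow_eq_act {X Y : SkeletalObj hc} (a : A) (h : X.as = Y.as) :
    arrow a h = (ofCocycle hc).act (arrow 1 h) a := by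
  rw [ofCocycle_act]
  exact Subtype.ext (one_mul a).symm

/-- A monoidal functor turns a bracketing relation in the source into one in the target. -/
lemma Hom.associator_map {S T : CategoricalCentralExtension G} (f : Hom S T) {x y z w : S.Obj}
    {r : (x ⊗ y) ⊗ z ⟶ w} {r' : x ⊗ y ⊗ z ⟶ w} {a : S.A} (h : (α_ x y z).hom ≫ r' = S.act r a) :
    (α_ (f.F.obj x) (f.F.obj y) (f.F.obj z)).hom ≫
        f.F.obj x ◁ Functor.LaxMonoidal.μ f.F y z ≫
          Functor.LaxMonoidal.μ f.F x (y ⊗ z) ≫ f.F.map r' =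
      T.act (Functor.LaxMonoidal.μ f.F x y ▷ f.F.obj z ≫
        Functor.LaxMonoidal.μ f.F (x ⊗ y) z ≫ f.F.map r) (f.φ a) := by
  rw [← Functor.LaxMonoidal.associativity_assoc, ← Functor.map_comp, h, Hom.map_act, comp_act,
    comp_act]

namespace MulSystem

variable {T : CategoricalCentralExtension G} (M : MulSystem T)

/-- The identification of the objects over equal elements. -/
def tr {g h : G} (e : g = h) : M.X g ⟶ M.X h := eqToHom (congrArg M.X e)

lemma tr_rfl (g : G) : M.tr (rfl : g = g) = 𝟙 _ := rfl

lemma tr_comp {g h k : G} (e : g = h) (e' : h = k) : M.tr e ≫ M.tr e' = M.tr (e.trans e') :=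
  eqToHom_trans _ _

lemma m_tr {g h k l : G} (e : g * h = k) (e' : k = l) :
    M.m e ≫ M.tr e' = M.m (e.trans e') := by
  subst e'
  rw [tr_rfl, Category.comp_id]

lemma tr_whiskerRight_m {g g' h k : G} (e : g = g') (e' : g' * h = k) :
    M.tr e ▷ M.X h ≫ M.m e' = M.m (by rw [e, e']) := by
  subst e
  rw [tr_rfl, id_whiskerRight, Category.id_comp]

lemma whiskerLeft_tr_m {g h h' k : G} (e : h = h') (e' : g * h' = k) :
    M.X g ◁ M.tr e ≫ M.m e' = M.m (by rw [e, e']) := by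
  subst e
  rw [tr_rfl, MonoidalCategory.whiskerLeft_id, Category.id_comp]

variable {M} {φ : A ⟶ T.A}

/-- The unit constraint: it is determined by unitality at `1`. -/
lemma exists_unit (M : MulSystem T) : ∃ ε : 𝟙_ T.Obj ⟶ M.X 1,
    ε ▷ M.X 1 ≫ M.m (mul_one 1) = (λ_ (M.X 1)).hom := by
  obtain ⟨ε⟩ := nonempty_hom (T := T) (X := 𝟙_ T.Obj) (Y := M.X 1) (by rw [p_unit, M.p_X])
  obtain ⟨a, ha⟩ := T.exists_eq_act (ε ▷ M.X 1 ≫ M.m (mul_one 1)) (λ_ (M.X 1)).hom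
  exact ⟨T.act ε a, by rw [act_whiskerRight, act_comp_left, ha]⟩

section Unit

variable {ε : 𝟙_ T.Obj ⟶ M.X 1} (hε : ε ▷ M.X 1 ≫ M.m (mul_one 1) = (λ_ (M.X 1)).hom)
  {d : G → G → G → T.A} (hM : M.IsAssociator d)

include hε hM

lemma unit_left (g : G) :
    ε ▷ M.X g ≫ M.m (one_mul g) = T.act (λ_ (M.X g)).hom (d 1 1 g) := by
  obtain ⟨x, hx⟩ := T.exists_eq_act (λ_ (M.X g)).hom (ε ▷ M.X g ≫ M.m (one_mul g))
  rw [hx]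
  congr 1
  refine act_injective (f := (λ_ (M.X 1)).hom ▷ M.X g ≫ M.m (one_mul g)) ?_
  have h := congrArg (ε ▷ M.X 1 ▷ M.X g ≫ ·)
    (hM (mul_one 1) (one_mul g) (one_mul g) (one_mul g))
  rw [comp_act, ← comp_whiskerRight_assoc, hε] at h
  rw [← h, associator_naturality_left_assoc, ← whisker_exchange_assoc, hx]
  simp [comp_act]

lemma unit_right (g : G) :
    M.X g ◁ ε ≫ M.m (mul_one g) = T.act (ρ_ (M.X g)).hom (d g 1 1)⁻¹ := by
  obtain ⟨y, hy⟩ := T.exists_eq_act (ρ_ (M.X g)).hom (M.X g ◁ ε ≫ M.m (mul_one g))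
  rw [hy]
  congr 1
  refine eq_inv_of_mul_eq_one_left ?_
  refine act_injective (f := (ρ_ (M.X g)).hom ▷ M.X 1 ≫ M.m (mul_one g)) ?_
  have h := congrArg ((M.X g ◁ ε) ▷ M.X 1 ≫ ·)
    (hM (mul_one g) (mul_one 1) (mul_one g) (mul_one g))
  rw [comp_act, ← comp_whiskerRight_assoc, hy, act_whiskerRight, act_comp_left, act_act] at h
  rw [← h, associator_naturality_middle_assoc, ← MonoidalCategory.whiskerLeft_comp_assoc, hε,
    act_one]
  simp

end Unit

/-- The functor from a skeletal categorical group given by a multiplicative system. -/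
def functor (M : MulSystem T) (φ : A ⟶ T.A) (hc : IsTrivialCocycle₃ c) :
    SkeletalObj hc ⥤ T.Obj where
  obj x := M.X x.as
  map f := T.act (M.tr f.2) (φ f.1)
  map_id x := (congrArg (T.act (𝟙 _)) (map_one φ.hom)).trans (T.act_one _)
  map_comp f g := by
    rw [act_comp, tr_comp, ← map_mul]
    rfl

/-- The functor given by a multiplicative system is monoidal if the associator of the system is the
image of the cocycle. -/
noncomputable def coreMonoidal (M : MulSystem T) (φ : A ⟶ T.A)
    (hM : M.IsAssociator fun g h k => φ (c g h k)) {ε : 𝟙_ T.Obj ⟶ M.X 1}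
    (hε : ε ▷ M.X 1 ≫ M.m (mul_one 1) = (λ_ (M.X 1)).hom) :
    (M.functor φ hc).CoreMonoidal where
  εIso := (asIso ε : 𝟙_ T.Obj ≅ M.X 1)
  μIso x y := (asIso (M.m rfl) : M.X x.as ⊗ M.X y.as ≅ M.X (x.as * y.as))
  μIso_hom_natural_left {x y} f z := by
    change T.act (M.tr f.2) (φ f.1) ▷ M.X z.as ≫ M.m rfl = M.m rfl ≫ T.act (M.tr _) (φ f.1)
    rw [act_whiskerRight, act_comp_left, comp_act, tr_whiskerRight_m, m_tr]
  μIso_hom_natural_right {x y} z f := by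
    change M.X z.as ◁ T.act (M.tr f.2) (φ f.1) ≫ M.m rfl = M.m rfl ≫ T.act (M.tr _) (φ f.1)
    rw [whiskerLeft_act, act_comp_left, comp_act, whiskerLeft_tr_m, m_tr]
  associativity x y z := by
    change M.m rfl ▷ M.X z.as ≫ M.m rfl ≫ T.act (M.tr _) (φ (c x.as y.as z.as)) =
      (α_ (M.X x.as) (M.X y.as) (M.X z.as)).hom ≫ M.X x.as ◁ M.m rfl ≫ M.m rfl
    rw [hM rfl rfl (mul_assoc _ _ _) rfl, comp_act, comp_act, m_tr]
  left_unitality x := by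
    change (λ_ (M.X x.as)).hom =
      ε ▷ M.X x.as ≫ M.m rfl ≫ T.act (M.tr (one_mul x.as)) (φ (c 1 1 x.as)⁻¹)
    rw [comp_act, m_tr, comp_act, unit_left hε hM, act_act, ← map_mul, mul_inv_cancel, map_one,
      act_one]
  right_unitality x := by
    change (ρ_ (M.X x.as)).hom =
      M.X x.as ◁ ε ≫ M.m rfl ≫ T.act (M.tr (mul_one x.as)) (φ (c x.as 1 1))
    rw [comp_act, m_tr, comp_act, unit_right hε hM, act_act, inv_mul_cancel, act_one]

/-- A multiplicative system whose associator is the image of a cocycle gives a 1-morphism. -/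
lemma nonempty_hom (M : MulSystem T) (φ : A ⟶ T.A)
    (hM : M.IsAssociator fun g h k => φ (c g h k)) : Nonempty (ofCocycle hc ⟶ T) := by
  obtain ⟨ε, hε⟩ := M.exists_unit
  refine ⟨@Hom.mk G _ (ofCocycle hc) T φ (M.functor φ hc)
    (M.coreMonoidal φ hM hε).toMonoidal (fun a => ?_) fun x => M.p_X x.as⟩
  change ε ≫ T.act (𝟙 _) (φ a) = T.unitEnd (φ a) ≫ ε
  rw [comp_act, Category.comp_id, ← objAct_unit, objAct_comp, act_eq]

/-- The multiplicative system given by a 1-morphism from a skeletal categorical group. -/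
def ofHom (f : Hom (ofCocycle hc) T) : MulSystem T where
  X g := f.F.obj (⟨g⟩ : SkeletalObj hc)
  p_X g := f.p_F (⟨g⟩ : SkeletalObj hc)
  m {g h k} e := Functor.LaxMonoidal.μ f.F (⟨g⟩ : SkeletalObj hc) (⟨h⟩ : SkeletalObj hc) ≫
    f.F.map (arrow 1 e : (⟨g * h⟩ : SkeletalObj hc) ⟶ ⟨k⟩)

lemma ofHom_m_rfl (f : Hom (ofCocycle hc) T) (g h : G) : (ofHom f).m (rfl : g * h = _) =
    Functor.LaxMonoidal.μ f.F (⟨g⟩ : SkeletalObj hc) (⟨h⟩ : SkeletalObj hc) := by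
  refine (congrArg (_ ≫ ·) (f.F.map_id _)).trans (Category.comp_id _)

lemma ofHom_isAssociator (f : Hom (ofCocycle hc) T) :
    (ofHom f).IsAssociator fun g h k => f.φ (c g h k) := by
  rintro g h k _ _ _ rfl rfl rfl e₄
  rw [ofHom_m_rfl, ofHom_m_rfl]
  refine f.associator_map (x := (⟨g⟩ : SkeletalObj hc)) (y := (⟨h⟩ : SkeletalObj hc))
    (z := (⟨k⟩ : SkeletalObj hc)) (w := (⟨g * h * k⟩ : SkeletalObj hc)) ?_
  refine Eq.trans ?_ (ofCocycle_act _ _).symm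
  exact Subtype.ext ((mul_one _).trans (one_mul _).symm)

/-- A family of isomorphisms between the objects of two multiplicative systems is compatible with
products up to a 2-cochain, whose coboundary compares the associators. -/
lemma exists_comparison (M M' : MulSystem T) (t : ∀ g, M.X g ⟶ M'.X g) :
    ∃ b : G → G → T.A, ∀ {g h k : G} (e : g * h = k),
      (t g ⊗ₘ t h) ≫ M'.m e = T.act (M.m e ≫ t k) (b g h) := by
  choose b hb using fun g h => T.exists_eq_act (M.m (rfl : g * h = _) ≫ t (g * h))
    ((t g ⊗ₘ t h) ≫ M'.m (rfl : g * h = _))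
  refine ⟨b, ?_⟩
  rintro g h _ rfl
  exact hb g h

/-- The cochain that compares two multiplicative systems has as coboundary the quotient of their
associators. -/
lemma comparison_associator {M M' : MulSystem T} {t : ∀ g, M.X g ⟶ M'.X g} {b : G → G → T.A}
    (hb : ∀ {g h k : G} (e : g * h = k), (t g ⊗ₘ t h) ≫ M'.m e = T.act (M.m e ≫ t k) (b g h))
    {d d' : G → G → G → T.A} (hd : M.IsAssociator d) (hd' : M'.IsAssociator d') (g h k : G) :
    d g h k * (b h k * b g (h * k)) = d' g h k * (b g h * b (g * h) k) := by
  refine act_injective (f := M.m rfl ▷ M.X k ≫ M.m rfl ≫ t (g * h * k)) ?_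
  have e := (mul_assoc g h k).symm
  have h1 : (α_ _ _ _).hom ≫ (t g ⊗ₘ t h ⊗ₘ t k) ≫ M'.X g ◁ M'.m rfl ≫ M'.m e =
      T.act (M.m rfl ▷ M.X k ≫ M.m rfl ≫ t (g * h * k)) (d g h k * (b h k * b g (h * k))) := by
    have : (t g ⊗ₘ t h ⊗ₘ t k) ≫ M'.X g ◁ M'.m (rfl : h * k = _) =
        T.act (M.X g ◁ M.m rfl ≫ (t g ⊗ₘ t (h * k))) (b h k) := by
      rw [← id_tensorHom, tensorHom_comp_tensorHom, hb, Category.comp_id, act_tensorHom_right,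
        ← id_tensorHom, tensorHom_comp_tensorHom, Category.id_comp]
    rw [reassoc_of% this, act_comp_left, Category.assoc, hb e]
    simp only [comp_act, act_act]
    have := hd rfl rfl rfl e
    rw [reassoc_of% this, act_comp_left, act_act, Category.assoc]
    rw [mul_comm (b g (h * k))]
  have h2 : ((t g ⊗ₘ t h) ⊗ₘ t k) ≫ (α_ _ _ _).hom ≫ M'.X g ◁ M'.m rfl ≫ M'.m e =
      T.act (M.m rfl ▷ M.X k ≫ M.m rfl ≫ t (g * h * k)) (d' g h k * (b g h * b (g * h) k)) := by
    rw [hd' rfl rfl rfl e, comp_act]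
    have : ((t g ⊗ₘ t h) ⊗ₘ t k) ≫ M'.m (rfl : g * h = _) ▷ M'.X k =
        T.act (M.m rfl ▷ M.X k ≫ (t (g * h) ⊗ₘ t k)) (b g h) := by
      rw [← tensorHom_id, tensorHom_comp_tensorHom, hb, Category.comp_id, act_tensorHom_left,
        ← tensorHom_id, tensorHom_comp_tensorHom, Category.id_comp]
    rw [reassoc_of% this, act_comp_left, Category.assoc, hb]
    simp only [comp_act, act_act]
    rw [mul_comm _ (d' g h k), mul_comm (b (g * h) k)]
  rw [← h1, ← h2, associator_naturality_assoc]

end MulSystem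

/-! ### Categorical Schur covers -/

/-- All 2-morphisms are invertible. -/
noncomputable def isoOfHom {S T : CategoricalCentralExtension G} {f g : Hom S T} (s : f ⟶ g) :
    f ≅ g :=
  have : IsIso s.τ := NatIso.isIso_of_isIso_app _
  have : NatTrans.IsMonoidal (asIso s.τ).hom := s.isMonoidal
  isoMk (asIso s.τ)

/-- Isomorphic 1-morphisms induce the same homomorphism on centers. -/
lemma φ_eq_of_hom {S T : CategoricalCentralExtension G} {f g : Hom S T} (s : f ⟶ g) :
    f.φ = g.φ := by
  refine CommGrpCat.hom_ext (MonoidHom.ext fun a => ?_)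
  refine act_injective (f := s.τ.app (𝟙_ S.Obj)) ?_
  have h := s.τ.naturality (S.act (𝟙 (𝟙_ S.Obj)) a)
  rw [f.map_act, g.map_act, comp_act, act_comp_left] at h
  have h' : T.act (s.τ.app (𝟙_ S.Obj)) (f.φ a) = T.act (s.τ.app (𝟙_ S.Obj)) (g.φ a) := by
    simpa using h
  exact h'

/-- Over a perfect group, 1-morphisms from a skeletal categorical group have no nontrivial
automorphisms: two monoidal transformations differ by a homomorphism from `G` to the center. -/
lemma subsingleton_hom_ofCocycle (hG : Group.IsPerfect G) {T : CategoricalCentralExtension G}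
    (f f' : Hom (ofCocycle hc) T) : Subsingleton (f ⟶ f') := by
  refine ⟨fun s s' => ?_⟩
  let x (g : G) : (ofCocycle hc).Obj := (⟨g⟩ : SkeletalObj hc)
  choose k hk using fun g : G => T.exists_eq_act (s.τ.app (x g)) (s'.τ.app (x g))
  have hk1 := eq_one_of_isPerfect hG k fun g h => by
    have h1 := NatTrans.IsMonoidal.tensor (τ := s.τ) (x g) (x h)
    have h2 := NatTrans.IsMonoidal.tensor (τ := s'.τ) (x g) (x h)
    have h3 : s'.τ.app (x g ⊗ x h) = T.act (s.τ.app (x g ⊗ x h)) (k (g * h)) := hk (g * h)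
    rw [hk g, hk h, h3, act_tensorHom, act_comp_left, comp_act, h1] at h2
    exact act_injective h2
  apply hom₂_ext
  intro y
  have := hk (SkeletalObj.as y)
  rw [hk1, act_one] at this
  exact this.symm

/-- A superperfect group has a categorical Schur cover with center `H₃(G)`. -/
theorem exists_categoricalSchurCover (hG : IsSuperperfect G) :
    ∃ S : CategoricalCentralExtension G, S.IsCategoricalSchurCover ∧
      S.A = integralHomology G 3 := by
  obtain ⟨u, hu, hex, huniq⟩ := exists_universal_cocycle₃ G hG
  refine ⟨ofCocycle hu, fun T => ⟨?_, fun f f' => ?_⟩, rfl⟩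
  · obtain ⟨M⟩ := MulSystem.nonempty T
    obtain ⟨c, hc⟩ := M.exists_isAssociator
    obtain ⟨φ, b, h⟩ := hex T.A c hc.isTrivialCocycle₃
    exact (M.twist fun g h => (b g h)⁻¹).nonempty_hom (CommGrpCat.ofHom φ) (hc.twist b h)
  · change Hom (ofCocycle hu) T at f
    change Hom (ofCocycle hu) T at f'
    have hsub : Subsingleton (f ≅ f') :=
      have := subsingleton_hom_ofCocycle hG.1 f f'
      ⟨fun e e' => Iso.ext (Subsingleton.elim _ _)⟩
    suffices Nonempty (f ⟶ f') from
      ⟨@Unique.mk' _ ⟨isoOfHom this.some⟩ hsub⟩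
    let M := MulSystem.ofHom f
    let M' := MulSystem.ofHom f'
    let t (g : G) : M.X g ⟶ M'.X g := (CategoricalCentralExtension.nonempty_hom
      ((M.p_X g).trans (M'.p_X g).symm)).some
    obtain ⟨b, hb⟩ := MulSystem.exists_comparison M M' t
    have hcomp := MulSystem.comparison_associator hb
      (MulSystem.ofHom_isAssociator f) (MulSystem.ofHom_isAssociator f')
    -- the comparison cochain shows that `f` and `f'` agree on centers
    have hφ : f.φ.hom / f'.φ.hom = 1 := by
      refine huniq T.A _ (fun g h => (b g h)⁻¹) fun g h k => ?_
      change f.φ (u g h k) / f'.φ (u g h k) = _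
      have := hcomp g h k
      rw [coboundary₂, ← mul_inv, ← mul_inv, inv_div_inv, div_eq_div_iff_mul_eq_mul, this,
        mul_comm]
    have hφ' : f.φ = f'.φ := CommGrpCat.hom_ext (div_eq_one.1 hφ)
    -- so it is a cocycle, hence a coboundary, with which `t` can be corrected
    obtain ⟨κ, hκ⟩ := exists_eq_coboundary₁ G hG b fun g h k => by
      have := hcomp g h k
      rw [hφ'] at this
      exact (mul_left_cancel this).symm
    let x (g : G) : (ofCocycle hu).Obj := (⟨g⟩ : SkeletalObj hu)
    let t' (g : G) : f.F.obj (x g) ⟶ f'.F.obj (x g) := T.act (t g) (κ g)⁻¹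
    let τ : f.F ⟶ f'.F :=
      { app := fun y => t' (SkeletalObj.as y)
        naturality := by
          rintro ⟨g⟩ ⟨h⟩ ⟨a, e⟩
          obtain rfl : g = h := e
          change f.F.map (arrow a rfl : (⟨g⟩ : SkeletalObj hu) ⟶ ⟨g⟩) ≫ t' g =
            t' g ≫ f'.F.map (arrow a rfl : (⟨g⟩ : SkeletalObj hu) ⟶ ⟨g⟩)
          have h : (arrow a rfl : (⟨g⟩ : SkeletalObj hu) ⟶ ⟨g⟩) =
            (ofCocycle hu).act (𝟙 (x g)) a := arrow_eq_act a rfl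
          have h1 : f.F.map (arrow a rfl : (⟨g⟩ : SkeletalObj hu) ⟶ ⟨g⟩) =
              T.act (𝟙 (f.F.obj (x g))) (f.φ a) :=
            (congrArg f.F.map h).trans ((f.map_act _ _).trans
              (congrArg (fun y => T.act y (f.φ a)) (f.F.map_id _)))
          have h2 : f'.F.map (arrow a rfl : (⟨g⟩ : SkeletalObj hu) ⟶ ⟨g⟩) =
              T.act (𝟙 (f'.F.obj (x g))) (f'.φ a) :=
            (congrArg f'.F.map h).trans ((f'.map_act _ _).trans
              (congrArg (fun y => T.act y (f'.φ a)) (f'.F.map_id _)))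
          rw [h1, h2, hφ', act_comp_left, comp_act, Category.id_comp, Category.comp_id] }
    have hτ : NatTrans.IsMonoidal τ := isMonoidal_of_tensor τ fun ⟨g⟩ ⟨h⟩ => by
      have h1 : (T.act (t g) (κ g)⁻¹ ⊗ₘ T.act (t h) (κ h)⁻¹) ≫ M'.m (rfl : g * h = _) =
          M.m (rfl : g * h = _) ≫ T.act (t (g * h)) (κ (g * h))⁻¹ := by
        rw [act_tensorHom, act_comp_left, comp_act, hb, act_act, hκ, coboundary₁, ← mul_inv,
          div_mul_eq_mul_div, mul_inv_cancel, one_div]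
      rw [MulSystem.ofHom_m_rfl, MulSystem.ofHom_m_rfl] at h1
      exact h1.symm
    exact ⟨{ τ := τ }⟩

end CategoricalCentralExtension

namespace CategoricalCentralExtension

variable {G : Type u} [Group G]

/-! ### Maps from a pushout extension -/

section Pushout

open PushoutObj

variable (S : CategoricalCentralExtension G) {B : CommGrpCat.{u}} (φ : S.A ⟶ B)

/-- The functor `𝒢 ⥤ 𝒢[φ]`, `f ↦ [f, 1]`. -/
def toPushoutFunctor : S.Obj ⥤ S.PushoutObj φ where
  obj X := ⟨X⟩
  map f := homMk f 1
  map_comp _ _ := homMk_congr rfl (one_mul 1).symm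

instance toPushoutMonoidal : (S.toPushoutFunctor φ).Monoidal :=
  Functor.CoreMonoidal.toMonoidal
    { εIso := mkIso (Iso.refl (𝟙_ S.Obj))
      μIso := fun X Y => mkIso (Iso.refl (X ⊗ Y))
      μIso_hom_natural_left := fun {X Y} x X' =>
        homMk_congr ((Category.comp_id _).trans (Category.id_comp _).symm) rfl
      μIso_hom_natural_right := fun {X Y} X' x =>
        homMk_congr ((Category.comp_id _).trans (Category.id_comp _).symm) rfl
      associativity := fun X Y Z => by
        refine homMk_congr (Y := ⟨X ⊗ Y ⊗ Z⟩)
          (f := 𝟙 (X ⊗ Y) ▷ Z ≫ 𝟙 _ ≫ (α_ X Y Z).hom)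
          (f' := (α_ X Y Z).hom ≫ X ◁ 𝟙 (Y ⊗ Z) ≫ 𝟙 _) ?_ ?_
        · simp
        · simp
      left_unitality := fun X => by
        refine homMk_congr (φ := φ) (Y := ⟨X⟩) (f := (λ_ X).hom)
          (f' := 𝟙 (𝟙_ S.Obj) ▷ X ≫ 𝟙 _ ≫ (λ_ X).hom)
          (b := 1) (b' := (1 : B) * ((1 : B) * (1 : B))) ?_ ?_
        · simp
        · simp
      right_unitality := fun X => by
        refine homMk_congr (φ := φ) (Y := ⟨X⟩) (f := (ρ_ X).hom)
          (f' := X ◁ 𝟙 (𝟙_ S.Obj) ≫ 𝟙 _ ≫ (ρ_ X).hom)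
          (b := 1) (b' := (1 : B) * ((1 : B) * (1 : B))) ?_ ?_
        · simp
        · simp }

/-- The canonical 1-morphism `𝒢 → 𝒢[φ]`. -/
noncomputable def toPushout : Hom S (S.pushoutExtension φ) :=
  @Hom.mk G _ S (S.pushoutExtension φ) φ (S.toPushoutFunctor φ) (S.toPushoutMonoidal φ)
    (fun a => by
      change (homMk (𝟙 (𝟙_ S.Obj)) 1 : 𝟙_ (S.PushoutObj φ) ⟶ 𝟙_ (S.PushoutObj φ)) ≫
        (homMk (S.unitEnd a) 1 : 𝟙_ (S.PushoutObj φ) ⟶ 𝟙_ (S.PushoutObj φ)) =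
        (homMk (𝟙 (𝟙_ S.Obj)) (φ a) : 𝟙_ (S.PushoutObj φ) ⟶ 𝟙_ (S.PushoutObj φ)) ≫
        (homMk (𝟙 (𝟙_ S.Obj)) 1 : 𝟙_ (S.PushoutObj φ) ⟶ 𝟙_ (S.PushoutObj φ))
      rw [homMk_comp, homMk_comp, homMk_eq_iff]
      refine ⟨a, ?_, by simp⟩
      change (𝟙 (𝟙_ S.Obj) ≫ S.unitEnd a : 𝟙_ S.Obj ⟶ 𝟙_ S.Obj) =
        S.act (𝟙 (𝟙_ S.Obj) ≫ 𝟙 (𝟙_ S.Obj)) a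
      rw [Category.id_comp, Category.id_comp, act_eq, Category.id_comp, objAct_unit])
    (fun _ => rfl)

variable {S φ}

lemma pushout_act {X Y : S.PushoutObj φ} (f : X.as ⟶ Y.as) (b : B) :
    (S.pushoutExtension φ).act (homMk f 1 : X ⟶ Y) b = homMk f b := by
  refine homMk_congr (f := (ρ_ X.as).inv ≫ (f ⊗ₘ 𝟙 _) ≫ (ρ_ Y.as).hom)
    (b := (1 : B) * ((1 * b) * 1)) ?_ ?_
  · simp
  · simp

section OfPushout

variable {T : CategoricalCentralExtension G} (f : Hom S T) (ψ : B ⟶ T.A) (w : φ ≫ ψ = f.φ)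

include w in
lemma ofPushout_aux {X Y : S.Obj} (g : X ⟶ Y) (a : S.A) (b : B) :
    T.act (f.F.map (S.act g a)) (ψ b) = T.act (f.F.map g) (ψ (φ a * b)) := by
  rw [f.map_act, act_act, ← w, map_mul]
  rfl

/-- The functor `𝒢[φ] ⥤ ℋ`, `[g, b] ↦ f(g) • ψ(b)`, for `f : 𝒢 → ℋ`. -/
def ofPushoutFunctor : S.PushoutObj φ ⥤ T.Obj where
  obj X := f.F.obj X.as
  map := Quotient.lift (fun x => T.act (f.F.map x.1) (ψ x.2)) (by
    rintro ⟨g, b⟩ ⟨g', b'⟩ ⟨a, h1, h2⟩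
    dsimp only at h1 h2 ⊢
    rw [h1, h2, ofPushout_aux f ψ w])
  map_id X := by
    change T.act (f.F.map (𝟙 X.as)) (ψ 1) = _
    rw [f.F.map_id, map_one, act_one]
  map_comp x y := by
    obtain ⟨g, b, rfl⟩ := homMk_surj x
    obtain ⟨h, c, rfl⟩ := homMk_surj y
    change T.act (f.F.map (g ≫ h)) (ψ (b * c)) =
      T.act (f.F.map g) (ψ b) ≫ T.act (f.F.map h) (ψ c)
    rw [act_comp, f.F.map_comp, map_mul]

lemma ofPushoutFunctor_map {X Y : S.PushoutObj φ} (g : X.as ⟶ Y.as) (b : B) :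
    (ofPushoutFunctor f ψ w).map (homMk g b : X ⟶ Y) = T.act (f.F.map g) (ψ b) := rfl

lemma ofPushoutFunctor_map_one {X Y : S.PushoutObj φ} (g : X.as ⟶ Y.as) :
    (ofPushoutFunctor f ψ w).map (homMk g 1 : X ⟶ Y) = f.F.map g := by
  rw [ofPushoutFunctor_map, map_one, act_one]

instance ofPushoutMonoidal : (ofPushoutFunctor f ψ w).Monoidal :=
  Functor.CoreMonoidal.toMonoidal
    { εIso := Functor.Monoidal.εIso f.F
      μIso := fun X Y => Functor.Monoidal.μIso f.F X.as Y.as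
      μIso_hom_natural_left := fun {X Y} x Z => by
        obtain ⟨g, b, rfl⟩ := homMk_surj x
        change T.act (f.F.map g) (ψ b) ▷ f.F.obj Z.as ≫ Functor.LaxMonoidal.μ f.F _ _ =
          Functor.LaxMonoidal.μ f.F _ _ ≫ T.act (f.F.map (g ▷ Z.as)) (ψ b)
        rw [act_whiskerRight, act_comp_left, comp_act, Functor.LaxMonoidal.μ_natural_left]
      μIso_hom_natural_right := fun {X Y} Z x => by
        obtain ⟨g, b, rfl⟩ := homMk_surj x
        change f.F.obj Z.as ◁ T.act (f.F.map g) (ψ b) ≫ Functor.LaxMonoidal.μ f.F _ _ =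
          Functor.LaxMonoidal.μ f.F _ _ ≫ T.act (f.F.map (Z.as ◁ g)) (ψ b)
        rw [whiskerLeft_act, act_comp_left, comp_act, Functor.LaxMonoidal.μ_natural_right]
      associativity := fun X Y Z => by
        have h := Functor.LaxMonoidal.associativity f.F X.as Y.as Z.as
        rw [← ofPushoutFunctor_map_one f ψ w (X := ⟨(X.as ⊗ Y.as) ⊗ Z.as⟩)
          (Y := ⟨X.as ⊗ Y.as ⊗ Z.as⟩)] at h
        exact h
      left_unitality := fun X => by
        have h := Functor.LaxMonoidal.left_unitality f.F X.as
        rw [← ofPushoutFunctor_map_one f ψ w (X := ⟨𝟙_ _ ⊗ X.as⟩) (Y := ⟨X.as⟩)] at h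
        exact h
      right_unitality := fun X => by
        have h := Functor.LaxMonoidal.right_unitality f.F X.as
        rw [← ofPushoutFunctor_map_one f ψ w (X := ⟨X.as ⊗ 𝟙_ _⟩) (Y := ⟨X.as⟩)] at h
        exact h }

/-- The 1-morphism `𝒢[φ] → ℋ` induced by `f : 𝒢 → ℋ` if the homomorphism on centers factors
through `φ`. -/
noncomputable def ofPushout : Hom (S.pushoutExtension φ) T :=
  @Hom.mk G _ (S.pushoutExtension φ) T ψ (ofPushoutFunctor f ψ w) (ofPushoutMonoidal f ψ w)
    (fun b => by
      change Functor.LaxMonoidal.ε f.F ≫ T.act (f.F.map (𝟙 _)) (ψ b) =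
        T.unitEnd (ψ b) ≫ Functor.LaxMonoidal.ε f.F
      rw [comp_act, f.F.map_id, Category.comp_id, ← objAct_unit, objAct_comp, act_eq])
    (fun X => f.p_F X.as)

end OfPushout

section Restrict

variable {T : CategoricalCentralExtension G}

/-- A 2-morphism between the restrictions to `𝒢` of 1-morphisms from `𝒢[φ]` that agree on the center
extends to `𝒢[φ]`. -/
lemma nonempty_hom_of_restrict {f f' : Hom (S.pushoutExtension φ) T} (h : f.φ = f'.φ)
    (s : (S.toPushout φ ≫ f : S ⟶ T) ⟶ S.toPushout φ ≫ f') : Nonempty (f ⟶ f') := by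
  let x (X : S.Obj) : (S.pushoutExtension φ).Obj := (⟨X⟩ : S.PushoutObj φ)
  let t (X : S.Obj) : f.F.obj (x X) ⟶ f'.F.obj (x X) := s.τ.app X
  let τ : f.F ⟶ f'.F :=
    { app := fun X => t (PushoutObj.as X)
      naturality := by
        rintro ⟨X⟩ ⟨Y⟩ y
        obtain ⟨g, b, rfl⟩ := homMk_surj (X := (⟨X⟩ : S.PushoutObj φ)) (Y := ⟨Y⟩) y
        let y₁ : x X ⟶ x Y := (homMk g 1 : (⟨X⟩ : S.PushoutObj φ) ⟶ ⟨Y⟩)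
        have h0 : f.F.map y₁ ≫ t Y = t X ≫ f'.F.map y₁ := s.τ.naturality g
        have hy : (homMk g b : (⟨X⟩ : S.PushoutObj φ) ⟶ ⟨Y⟩) =
          (S.pushoutExtension φ).act y₁ b := (pushout_act g b).symm
        have h1 := (congrArg f.F.map hy).trans (f.map_act y₁ b)
        have h2 := (congrArg f'.F.map hy).trans (f'.map_act y₁ b)
        refine (congrArg (· ≫ t Y) h1).trans (Eq.trans ?_ (congrArg (t X ≫ ·) h2).symm)
        dsimp only
        rw [act_comp_left, comp_act, h0, h] }
  have hτ : NatTrans.IsMonoidal τ := isMonoidal_of_tensor τ fun ⟨X⟩ ⟨Y⟩ => by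
    have h0 := NatTrans.IsMonoidal.tensor (τ := s.τ) X Y
    have hμ (k : Hom (S.pushoutExtension φ) T) :
        Functor.LaxMonoidal.μ (Hom.F (S.toPushout φ ≫ k : S ⟶ T)) X Y =
          Functor.LaxMonoidal.μ k.F (x X) (x Y) := by
      refine Eq.trans ?_ (Category.comp_id _)
      exact congrArg (_ ≫ ·) (k.F.map_id _)
    rw [hμ, hμ] at h0
    exact h0
  exact ⟨{ τ := τ }⟩

lemma subsingleton_hom_of_restrict {f f' : Hom (S.pushoutExtension φ) T}
    (h : Subsingleton ((S.toPushout φ ≫ f : S ⟶ T) ⟶ S.toPushout φ ≫ f')) :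
    Subsingleton (f ⟶ f') := by
  refine ⟨fun s s' => ?_⟩
  apply hom₂_ext
  intro X
  let W (t : f ⟶ f') : (S.toPushout φ ≫ f : S ⟶ T) ⟶ S.toPushout φ ≫ f' :=
    @Bicategory.whiskerLeft (CategoricalCentralExtension G) _ S _ T (S.toPushout φ) f f' t
  exact congrArg (fun t => t.τ.app (PushoutObj.as X)) (Subsingleton.elim (W s) (W s'))

end Restrict

end Pushout

/-! ### Equivalences of central categorical extensions -/

section Equivalence

variable {S T : CategoricalCentralExtension G}

lemma Hom.isEquivalence (f : Hom S T) (hf : Function.Bijective f.φ) : f.F.IsEquivalence where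
  faithful := ⟨fun {X Y g g'} h => by
    obtain ⟨a, rfl⟩ := S.exists_eq_act g g'
    have h2 : 1 = f.φ a := act_injective (f := f.F.map g) (by rw [act_one, ← f.map_act]; exact h)
    rw [hf.1 (h2.symm.trans (map_one f.φ.hom).symm), act_one]⟩
  full := ⟨fun {X Y} g => by
    have h : S.p X = S.p Y := by rw [← f.p_F, ← f.p_F, p_eq_of_hom g]
    obtain ⟨k⟩ := nonempty_hom h
    obtain ⟨a, ha⟩ := T.exists_eq_act (f.F.map k) g
    obtain ⟨b, rfl⟩ := hf.2 a
    exact ⟨S.act k b, by rw [f.map_act, ha]⟩⟩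
  essSurj := ⟨fun Y => by
    obtain ⟨X, hX⟩ := S.p_surjective (T.p Y)
    exact ⟨X, (T.p_eq_iff _ _).1 (by rw [f.p_F, hX])⟩⟩

/-- A 1-morphism that is an isomorphism on centers is an equivalence. -/
lemma Hom.nonempty_equivalence (f : Hom S T) (hf : Function.Bijective f.φ) :
    Nonempty (Bicategory.Equivalence S T) := by
  have := f.isEquivalence hf
  let e := f.F.asEquivalence
  let : e.functor.Monoidal := f.monoidal
  let : e.inverse.Monoidal := e.inverseMonoidal
  have hmon : e.IsMonoidal := by
    have h : letI := e.toAdjunction.rightAdjointLaxMonoidal; e.toAdjunction.IsMonoidal :=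
      inferInstance
    exact h
  let e' := MulEquiv.ofBijective f.φ.hom hf
  let g : Hom T S :=
    { φ := CommGrpCat.ofHom e'.symm.toMonoidHom
      F := e.inverse
      F_ι := fun a => by
        have := f.isEquivalence hf
        have hb : f.φ (e'.symm a) = a := e'.apply_symm_apply a
        have h1 : T.unitEnd a = T.act (𝟙 _) a := by rw [act_eq, Category.id_comp, objAct_unit]
        have h2 : S.unitEnd (e'.symm a) = S.act (𝟙 _) (e'.symm a) := by
          rw [act_eq, Category.id_comp, objAct_unit]
        change Functor.LaxMonoidal.ε e.inverse ≫ e.inverse.map (T.unitEnd a) =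
          S.unitEnd (e'.symm a) ≫ Functor.LaxMonoidal.ε e.inverse
        refine f.F.map_injective ?_
        let k : f.F.obj (e.inverse.obj (𝟙_ T.Obj)) ⟶ 𝟙_ T.Obj := e.counit.app (𝟙_ T.Obj)
        have hnat : f.F.map (e.inverse.map (T.unitEnd a)) ≫ k = k ≫ T.unitEnd a :=
          e.counit.naturality (T.unitEnd a)
        rw [← cancel_mono k, f.F.map_comp, f.F.map_comp, Category.assoc,
          hnat, h1, h2, f.map_act, hb, f.F.map_id, act_comp_left, act_comp_left, comp_act,
          comp_act, Category.comp_id, Category.id_comp]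
      p_F := fun Y => by
        rw [← f.p_F]
        exact p_eq_of_hom (e.counit.app Y) }
  let η : (𝟙 S : S ⟶ S) ≅ (f ≫ g : S ⟶ S) :=
    @isoMk G _ S S (𝟙 S) (f ≫ g : S ⟶ S) e.unitIso (inferInstanceAs (NatTrans.IsMonoidal e.unit))
  let ε : (g ≫ f : T ⟶ T) ≅ 𝟙 T :=
    @isoMk G _ T T (g ≫ f : T ⟶ T) (𝟙 T) e.counitIso
      (inferInstanceAs (NatTrans.IsMonoidal e.counit))
  exact ⟨Bicategory.Equivalence.mkOfAdjointifyCounit η ε⟩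

end Equivalence

/-! ### The universal property of categorical Schur covers -/

section Universal

variable {S T : CategoricalCentralExtension G}

lemma IsCategoricalSchurCover.subsingleton_hom (hS : S.IsCategoricalSchurCover)
    (f g : S ⟶ T) : Subsingleton (f ⟶ g) :=
  ⟨fun s t => by
    obtain ⟨h⟩ := (hS T).2 f g
    exact congrArg Iso.hom (Subsingleton.elim (isoOfHom s) (isoOfHom t))⟩

lemma IsCategoricalSchurCover.nonempty_hom₂ (hS : S.IsCategoricalSchurCover) (f g : S ⟶ T) :
    Nonempty (f ⟶ g) := by
  obtain ⟨h⟩ := (hS T).2 f g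
  exact ⟨h.default.hom⟩

/-- The centers of two categorical Schur covers are isomorphic. -/
lemma IsCategoricalSchurCover.nonempty_iso (hS : S.IsCategoricalSchurCover)
    (hT : T.IsCategoricalSchurCover) : Nonempty (S.A ≅ T.A) := by
  obtain ⟨f⟩ := (hS T).1
  obtain ⟨g⟩ := (hT S).1
  obtain ⟨s⟩ := hS.nonempty_hom₂ (f ≫ g) (𝟙 S)
  obtain ⟨t⟩ := hT.nonempty_hom₂ (g ≫ f) (𝟙 T)
  exact ⟨⟨f.φ, g.φ, φ_eq_of_hom s, φ_eq_of_hom t⟩⟩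

/-- If `S` is initial, every central categorical extension is a pushout of it, in an essentially
unique way. -/
theorem IsCategoricalSchurCover.pushout_isBiequivalence (hS : S.IsCategoricalSchurCover)
    {H : CommGrpCat.{u}} (ι : H ≅ S.A) : (S.pushout ι.inv).IsBiequivalence where
  essSurj T := by
    obtain ⟨f⟩ := (hS T).1
    let K : Hom (S.pushoutExtension (ι.inv ≫ ι.hom ≫ f.φ)) T := ofPushout f (𝟙 _) (by simp)
    exact ⟨⟨Under.mk (ι.hom ≫ f.φ)⟩, K.nonempty_equivalence Function.bijective_id⟩
  isEquivalence X Y := by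
    let q := S.toPushout (ι.inv ≫ X.as.hom)
    have hsub (f g : Hom (S.pushoutExtension (ι.inv ≫ X.as.hom))
        (S.pushoutExtension (ι.inv ≫ Y.as.hom))) : Subsingleton (f ⟶ g) :=
      subsingleton_hom_of_restrict (hS.subsingleton_hom _ _)
    have hfaithful : ((S.pushout ι.inv).mapFunctor X Y).Faithful :=
      ⟨fun _ => Subsingleton.elim _ _⟩
    have hfull : ((S.pushout ι.inv).mapFunctor X Y).Full := ⟨fun {f g} t => by
      have h : f.as.right = g.as.right := φ_eq_of_hom t
      obtain rfl : f = g := Discrete.ext (Under.UnderMorphism.ext h)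
      exact ⟨𝟙 f, (hsub _ _).elim _ _⟩⟩
    have hess : ((S.pushout ι.inv).mapFunctor X Y).EssSurj := ⟨fun f => by
      change Hom (S.pushoutExtension (ι.inv ≫ X.as.hom))
        (S.pushoutExtension (ι.inv ≫ Y.as.hom)) at f
      obtain ⟨s⟩ := hS.nonempty_hom₂ (S.toPushout _ ≫ f : S ⟶ _) (S.toPushout _)
      have h1 : (ι.inv ≫ X.as.hom) ≫ f.φ = ι.inv ≫ Y.as.hom := φ_eq_of_hom s
      have h2 : X.as.hom ≫ f.φ = Y.as.hom :=
        (cancel_epi ι.inv).1 ((Category.assoc _ _ _).symm.trans h1)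
      let k : X ⟶ Y := ⟨Under.homMk f.φ h2⟩
      let f' : Hom (S.pushoutExtension (ι.inv ≫ X.as.hom))
        (S.pushoutExtension (ι.inv ≫ Y.as.hom)) := (S.pushout ι.inv).map k
      have hφ : f'.φ = f.φ := rfl
      obtain ⟨t⟩ := hS.nonempty_hom₂ (S.toPushout _ ≫ f' : S ⟶ _) (S.toPushout _ ≫ f)
      obtain ⟨t'⟩ := nonempty_hom_of_restrict hφ t
      exact ⟨k, ⟨isoOfHom t'⟩⟩⟩
    exact {}

end Universal

end CategoricalCentralExtension

theorem mainTheorem6 (G : Type u) [Group G] :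
    (Group.IsPerfect G →
      (∃ S : CentralExtension G, S.IsSchurCover) ∧
      ∀ S : CentralExtension G, S.IsSchurCover →
        Nonempty (integralHomology G 2 ≅ S.A) ∧
        ∀ ι : integralHomology G 2 ≅ S.A, (S.pushout ι.inv).IsEquivalence) ∧
    (IsSuperperfect G →
      (∃ S : CategoricalCentralExtension G, S.IsCategoricalSchurCover) ∧
      ∀ S : CategoricalCentralExtension G, S.IsCategoricalSchurCover →
        Nonempty (integralHomology G 3 ≅ S.A) ∧
        ∀ ι : integralHomology G 3 ≅ S.A, (S.pushout ι.inv).IsBiequivalence) := by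
  refine ⟨fun hG => ?_, fun hG => ?_⟩
  · obtain ⟨U, hU, hA⟩ := CentralExtension.exists_schurCover hG
    exact ⟨⟨U, hU⟩, fun S hS => ⟨hA ▸ hU.nonempty_iso hS, hS.pushout_isEquivalence⟩⟩
  · obtain ⟨U, hU, hA⟩ := CategoricalCentralExtension.exists_categoricalSchurCover hG
    exact ⟨⟨U, hU⟩, fun S hS => ⟨hA ▸ hU.nonempty_iso hS, hS.pushout_isBiequivalence⟩⟩
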